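/- **Setting.** All graphs are finite, simple and undirected. Fix a function $s\colon\mathbb N\to\mathbb N$ with $s(n)/n\to\infty$ (for example a polynomial of degree at least 2), and $\Delta\in\mathbb N$; every graph in the family $\mathcal F$ has maximum degree at most $\Delta$. *Lifts.* A covering map from $\mathcal H$ to $\mathcal G$ is a surjective map $\varphi\colon V(\mathcal H)\to V(\mathcal G)$ that maps the neighbours of $u$ bijectively onto the neighbours of $\varphi(u)$, for each $u\in V(\mathcal H)$; then $\mathcal H$ is a lift of $\mathcal G$. A family is closed under (connected) lifts if with a (connected) graph $\mathcal G$ it contains all (connected) lifts of $\mathcal G$. *Problems.* A simple graph problem $\Pi$ specifies for each graph which subsets of nodes (or, for another kind of problem, of edges) are feasible solutions, and whether their size is to be minimised or maximised. For real $\alpha$, a feasible solution $X$ is an $\alpha$-approximation if $|X|\le\alpha|Y|$ (minimisation), respectively $|Y|\le\alpha|X|$ (maximisation), for all feasible solutions $Y$. Solutions are described by local labels: one bit per node for sets of nodes; for sets of edges a vector in $\{0,1\}^\Delta$ per node whose $i$th component tells whether the $i$th edge incident to the node is in the set (both endpoints of an edge must be right; components beyond the degree are irrelevant in outputs and are $0$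 in inputs). *Local $\mathsf{ID}$-algorithms.* The nodes of a graph with $n$ nodes carry distinct identifiers from $\{1,\dots,s(n)\}$, and the edges incident to a node are ordered by the identifiers of their other endpoints. A local $\mathsf{ID}$-algorithm consists of a constant running time $r$ and an arbitrary function that determines the output of a node $u$ from the subgraph induced by the nodes within distance $r$ of $u$, with their identifiers and with $u$ marked. It finds an $\alpha$-approximation of $\Pi$ on $\mathcal F$ if for every $\mathcal G\in\mathcal F$ and every such choice of identifiers its outputs describe an $\alpha$-approximation of $\Pi$ on $\mathcal G$. *Local $\mathsf{PO}$-algorithms.* The edges incident to each node $u$ are numbered by ports $1,\dots,\deg(u)$, and each edge is oriented; an edge oriented from $u$ to $v$ is labelled by the pair of its port numbers at $u$ and at $v$. The view of $u$ is the rooted edge-labelled directed tree whose nodes are the non-backtracking walks starting at $u$, written as reduced words in the labels and their formal inverses. A local $\mathsf{PO}$-algorithm consists of a constant running time $r$ and a function that determines the output of a node from its view truncated to radius $r$, in which each walk also carries the local input, if any, of its end node. It finds an $\alpha$-approximation of $\Pi$ on $\mathcal F$ if for every $\mathcal G\in\mathcal F$, every port numbering and every orientation its outputs describe an $\alpha$-approximation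 of $\Pi$ on $\mathcal G$. *Checkability.* $\Pi$ is $\mathsf{PO}$-checkable (on $\mathcal F$) if there is a local $\mathsf{PO}$-algorithm that, for every $\mathcal G\in\mathcal F$, every port numbering and orientation, and every set $X$ of nodes (respectively edges) given by its local labels as inputs, outputs $1$ at all nodes if $X$ is feasible and outputs $0$ at some node otherwise. **Theorem.** Let $\Pi$ be a simple $\mathsf{PO}$-checkable graph problem and let $\alpha\in\mathbb R$. Assume that either (a) $\mathcal F$ is a family of graphs of maximum degree at most $\Delta$ that is closed under lifts, or (b) $\mathcal F$ is a family of connected graphs of maximum degree at most $\Delta$ that contains no trees and is closed under connected lifts. If there is a local $\mathsf{ID}$-algorithm that finds an $\alpha$-approximation of $\Pi$ on $\mathcal F$, then there is a local $\mathsf{PO}$-algorithm that finds an $\alpha$-approximation of $\Pi$ on $\mathcal F$. -/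

import Mathlib

/-- A finite simple undirected graph. -/
structure FinGraph where
  /-- The set of nodes. -/
  V : Type
  [finite : Finite V]
  /-- The adjacency relation. -/
  graph : SimpleGraph V

attribute [instance] FinGraph.finite

namespace FinGraph

/-- The set of neighbours of a node. -/
def nbrs (G : FinGraph) (u : G.V) : Set G.V := G.graph.neighborSet u

/-- The degree of a node. -/
noncomputable def deg (G : FinGraph) (u : G.V) : ℕ := (G.nbrs u).ncard

/-- The radius-`r` neighbourhood of `u`. The distance takes values in `ℕ∞`, so nodes in other
components are at distance `⊤`. -/
def ball (G : FinGraph) (u : G.V) (r : ℕ) : Set G.V := {v | G.graph.edist u v ≤ (r : ℕ∞)}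

/-- Covering maps between graphs: surjective maps that restrict, for every node `u`, to a
bijection from the neighbours of `u` to the neighbours of the image of `u`. -/
def IsCovering (H G : FinGraph) (φ : H.V → G.V) : Prop :=
  Function.Surjective φ ∧ ∀ u : H.V, Set.BijOn φ (H.nbrs u) (G.nbrs (φ u))

/-- `H` is a lift of `G`. -/
def IsLift (H G : FinGraph) : Prop := ∃ φ : H.V → G.V, IsCovering H G φ

/-- Every node of every graph in the family has degree at most `Δ`. -/
def DegreeBounded (F : Set FinGraph) (Δ : ℕ) : Prop := ∀ G ∈ F, ∀ u : G.V, G.deg u ≤ Δ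

/-- The family is closed under lifts. -/
def ClosedUnderLifts (F : Set FinGraph) : Prop := ∀ G ∈ F, ∀ H : FinGraph, IsLift H G → H ∈ F

/-- The family is closed under connected lifts. -/
def ClosedUnderConnectedLifts (F : Set FinGraph) : Prop :=
  ∀ G ∈ F, ∀ H : FinGraph, G.graph.Connected → H.graph.Connected → IsLift H G → H ∈ F

end FinGraph

/-- Whether the solutions of a problem are sets of nodes or sets of edges. -/
inductive SolutionKind where
  | nodes
  | edges

/-- Whether the size of a solution is to be minimised or maximised. -/
inductive Goal where
  | minimise
  | maximise

/-- The objects of which a solution is a set: the nodes of `G`, or the edges of `G`. -/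
abbrev SolutionKind.Item : SolutionKind → FinGraph → Type
  | .nodes, G => G.V
  | .edges, G => G.graph.edgeSet

/-- A simple graph problem. -/
structure SimpleGraphProblem where
  kind : SolutionKind
  goal : Goal
  /-- The feasible solutions on each graph. -/
  Feasible : (G : FinGraph) → Set (kind.Item G) → Prop

/-- `X` is an `α`-approximation on `G`: it is feasible, and its size is within factor `α` of the
size of every feasible solution, in particular of an optimal one. -/
def SimpleGraphProblem.IsApprox (Pi : SimpleGraphProblem) (α : ℝ) (G : FinGraph)
    (X : Set (Pi.kind.Item G)) : Prop :=
  Pi.Feasible G X ∧ ∀ Y : Set (Pi.kind.Item G), Pi.Feasible G Y →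
    match Pi.goal with
    | .minimise => (X.ncard : ℝ) ≤ α * (Y.ncard : ℝ)
    | .maximise => (Y.ncard : ℝ) ≤ α * (X.ncard : ℝ)

/-- The local outputs (or local inputs) that describe a solution at one node: one bit if solutions
are sets of nodes, and one bit for each of (up to) `Δ` incident edges if they are sets of edges. -/
abbrev SolutionKind.Label (Δ : ℕ) : SolutionKind → Type
  | .nodes => Bool
  | .edges => Fin Δ → Bool

/-- The family `x` of local labels describes the solution `X`. Here `port u v` is the (zero-based)
index of the neighbour `v` in the ordering of the edges incident to `u`. For solutions that are
sets of edges, both endpoints of an edge have to be right about it; the components of `x u` whose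
index is not less than the degree of `u` are irrelevant. -/
def Describes (Δ : ℕ) (G : FinGraph) (port : G.V → G.V → ℕ) :
    (k : SolutionKind) → (G.V → k.Label Δ) → Set (k.Item G) → Prop
  | .nodes, x, X => ∀ u : G.V, x u = true ↔ u ∈ X
  | .edges, x, X => ∀ (u v : G.V) (h : G.graph.Adj u v) (i : Fin Δ), (i : ℕ) = port u v →
      (x u i = true ↔ ⟨s(u, v), h⟩ ∈ X)

open Classical in
/-- The encoding of a solution `X` by local labels, with components that do not correspond to an
incident edge set to `0`. -/
noncomputable def encode (Δ : ℕ) (G : FinGraph) (port : G.V → G.V → ℕ) :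
    (k : SolutionKind) → Set (k.Item G) → G.V → k.Label Δ
  | .nodes, X => fun u => decide (u ∈ X)
  | .edges, X => fun u i => decide (∃ (v : G.V) (h : G.graph.Adj u v), (i : ℕ) = port u v ∧
      ⟨s(u, v), h⟩ ∈ X)

/-! ### Networks with unique identifiers -/

/-- Unique identifiers from `{1, …, s n}`, where `n` is the number of nodes. -/
structure Identifiers (s : ℕ → ℕ) (G : FinGraph) where
  id : G.V → ℕ
  injective : Function.Injective id
  mem_Icc : ∀ u : G.V, id u ∈ Set.Icc 1 (s (Nat.card G.V))

/-- A graph whose nodes are natural numbers, with a distinguished node. -/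
structure PointedIDGraph where
  verts : Set ℕ
  Adj : ℕ → ℕ → Prop
  root : ℕ

namespace Identifiers

variable {s : ℕ → ℕ} {G : FinGraph}

/-- The radius-`r` neighbourhood of `u`, with identifiers as nodes: the subgraph induced by the
ball of radius `r` around `u`. -/
def neighbourhood (ι : Identifiers s G) (r : ℕ) (u : G.V) : PointedIDGraph where
  verts := ι.id '' G.ball u r
  Adj a b := ∃ v ∈ G.ball u r, ∃ w ∈ G.ball u r, ι.id v = a ∧ ι.id w = b ∧ G.graph.Adj v w
  root := ι.id u

/-- The incident edges of a node are ordered by the identifiers of the other endpoints. -/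
noncomputable def port (ι : Identifiers s G) (u v : G.V) : ℕ :=
  {w ∈ G.nbrs u | ι.id w < ι.id v}.ncard

end Identifiers

/-- A local `ID`-algorithm with outputs in `O`: a constant running time, and an arbitrary function
of the neighbourhood of that radius. -/
structure IDAlgorithm (O : Type) where
  radius : ℕ
  output : PointedIDGraph → O

/-- The output of the algorithm at node `u`. -/
def IDAlgorithm.run {O : Type} (A : IDAlgorithm O) {s : ℕ → ℕ} {G : FinGraph}
    (ι : Identifiers s G) (u : G.V) : O :=
  A.output (ι.neighbourhood A.radius u)

/-- The `ID`-algorithm finds an `α`-approximation of the problem on every graph of the family, for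
every choice of identifiers bounded by `s`. -/
def IDAlgorithm.FindsApprox (s : ℕ → ℕ) {Δ : ℕ} (Pi : SimpleGraphProblem)
    (A : IDAlgorithm (Pi.kind.Label Δ)) (α : ℝ) (F : Set FinGraph) : Prop :=
  ∀ G ∈ F, ∀ ι : Identifiers s G, ∃ X : Set (Pi.kind.Item G),
    Describes Δ G ι.port Pi.kind (A.run ι) X ∧ Pi.IsApprox α G X

/-! ### Anonymous networks with a port numbering and orientation -/

/-- A port numbering and an orientation. The ports of a node of degree `d` are `0, …, d - 1`. -/
structure PortsAndOrientation (G : FinGraph) where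
  /-- `port u v` is the port of `u` that leads to its neighbour `v`. -/
  port : G.V → G.V → ℕ
  port_bijOn : ∀ u : G.V, Set.BijOn (port u) (G.nbrs u) (Set.Iio (G.deg u))
  /-- `Arc u v` means that `u` and `v` are adjacent and the edge is oriented from `u` to `v`. -/
  Arc : G.V → G.V → Prop
  adj_of_arc : ∀ u v : G.V, Arc u v → G.graph.Adj u v
  orient : ∀ u v : G.V, G.graph.Adj u v → Xor (Arc u v) (Arc v u)

/-- The letters `ℓ = (ℓ, true)` and `ℓ⁻¹ = (ℓ, false)`, where the edge labels `ℓ` are pairs of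
port numbers. -/
abbrev Letter : Type := (ℕ × ℕ) × Bool

namespace PortsAndOrientation

variable {G : FinGraph}

/-- The label of the arc from `u` to `v`. -/
def label (P : PortsAndOrientation G) (u v : G.V) : ℕ × ℕ := (P.port u v, P.port v u)

/-- Following the letter `a` from `u` leads to `v`: a letter `ℓ` follows an outgoing arc labelled
`ℓ`, and a letter `ℓ⁻¹` follows an incoming arc labelled `ℓ` backwards. -/
def Step (P : PortsAndOrientation G) (u : G.V) (a : Letter) (v : G.V) : Prop :=
  match a with
  | (l, true) => P.Arc u v ∧ P.label u v = l
  | (l, false) => P.Arc v u ∧ P.label v u = l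

/-- The word `w` spells a walk from `u` to `v`. -/
def IsWalk (P : PortsAndOrientation G) : G.V → List Letter → G.V → Prop
  | u, [], v => u = v
  | u, a :: w, v => ∃ u' : G.V, P.Step u a u' ∧ P.IsWalk u' w v

/-- The view from `u` truncated to radius `r`, in a network where each node `v` has the local
input `x v`. The nodes of this tree are the reduced words of length at most `r` that spell a walk
starting at `u`; each is given together with the input of the node in which the walk ends. The
edges of the tree and their labels are determined by the words. -/
def view {I : Type} (P : PortsAndOrientation G) (x : G.V → I) (r : ℕ) (u : G.V) :
    Set (List Letter × I) :=
  {p | FreeGroup.IsReduced p.1 ∧ p.1.length ≤ r ∧ ∃ v : G.V, P.IsWalk u p.1 v ∧ p.2 = x v}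

end PortsAndOrientation

/-- A local `PO`-algorithm with local inputs in `I` and outputs in `O`: a constant running time,
and a function of the view truncated to that radius. -/
structure POAlgorithm (I O : Type) where
  radius : ℕ
  output : Set (List Letter × I) → O

/-- The output of the algorithm at node `u`. -/
def POAlgorithm.run {I O : Type} (B : POAlgorithm I O) {G : FinGraph}
    (P : PortsAndOrientation G) (x : G.V → I) (u : G.V) : O :=
  B.output (P.view x B.radius u)

/-- The problem is `PO`-checkable on the family: some local `PO`-algorithm, given the encoding of a
set `X` as local inputs, outputs `1` at all nodes if `X` is feasible, and `0` at some node
otherwise. -/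
def SimpleGraphProblem.POCheckable (Pi : SimpleGraphProblem) (Δ : ℕ) (F : Set FinGraph) : Prop :=
  ∃ C : POAlgorithm (Pi.kind.Label Δ) Bool,
    ∀ G ∈ F, ∀ (P : PortsAndOrientation G) (X : Set (Pi.kind.Item G)),
      (Pi.Feasible G X → ∀ u : G.V, C.run P (encode Δ G P.port Pi.kind X) u = true) ∧
      (¬ Pi.Feasible G X → ∃ u : G.V, C.run P (encode Δ G P.port Pi.kind X) u = false)

/-- The `PO`-algorithm (without local inputs) finds an `α`-approximation of the problem on every
graph of the family, for every port numbering and orientation. -/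
def POAlgorithm.FindsApprox {Δ : ℕ} (Pi : SimpleGraphProblem)
    (B : POAlgorithm Unit (Pi.kind.Label Δ)) (α : ℝ) (F : Set FinGraph) : Prop :=
  ∀ G ∈ F, ∀ P : PortsAndOrientation G, ∃ X : Set (Pi.kind.Item G),
    Describes Δ G P.port Pi.kind (B.run P fun _ => ()) X ∧ Pi.IsApprox α G X

/-! An `ID`-algorithm can exploit the numerical values of the identifiers and their order; both
advantages are taken away on a suitable lift. Values: by Ramsey's theorem there are sets of
identifiers on which the output on a tree-like neighbourhood depends only on the order of the
identifiers (`IsMonochromatic`). Order: walks are words in the edge labels, and the free group has a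
left-invariant order. If the ball of a node is a tree whose identifiers are ordered as this order
sorts the words, then the output of the algorithm is a function of the view, and `simulation`
computes it.

Such orderings exist on finite lifts up to a small fraction of the nodes
(`exists_homogeneous_perms`). The Magnus map sends a generator `x` to `1 + x` in power series in
non-commuting variables; it is faithful on the free group, and comparing coefficients
lexicographically, shorter monomials first, is unaffected by left multiplication by a series with
constant term 1. Only finitely many monomials are needed, and the coefficients are confined to a box
of side `N ^ length`. Right multiplication by a short word moves a coefficient at `m` by `O(N ^
(length m - 1))`, so it leaves the box only near the boundary, and the letters extend to
permutations of the box. These permutations define the lift.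

A lift `C` with `t` nodes may need far more than `s t` identifiers before a Ramsey set of size `t`
appears. Therefore `C` is covered once more by many levels that are copies of `C`, each with its own
Ramsey set; since `s n / n` tends to infinity there is room for all of them
(`exists_common_colour`). If the lift must be connected, the levels are linked along an edge that is
not a bridge, which exists since there are no trees, and only the nodes near that edge are spoiled.
This gives `exists_simulation`.

Views do not change under lifts, so the `PO`-algorithm produces a solution `X` on `G` whose lift
agrees with the `ID`-solution `Z` at most nodes. Feasibility of `X` is checked locally, in places
where the two agree. The size of `Z` is nearly `N` times that of `X`, every feasible `Y` on `G`
lifts to a feasible set `N` times as large, and the error disappears in the limit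
(`isApprox_of_forall_exists`). -/

/-! ### Ramsey's theorem and disjoint monochromatic blocks -/

theorem ramsey (C : Type*) [Finite C] (k : ℕ) : ∀ t : ℕ, ∃ R : ℕ, ∀ (f : Finset ℕ → C)
    (S : Finset ℕ), R ≤ S.card →
    ∃ T ⊆ S, T.card = t ∧ ∃ c, ∀ U ⊆ T, U.card = k → f U = c := by
  classical
  induction k with
  | zero =>
    intro t
    refine ⟨t, fun f S hS => ?_⟩
    obtain ⟨T, hT, hc⟩ := Finset.exists_subset_card_eq hS
    exact ⟨T, hT, hc, f ∅, fun U _ hU => by rw [Finset.card_eq_zero.mp hU]⟩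
  | succ k ih =>
    -- The argument of Erdős and Rado: on `T` the colour of a set of `k + 1` elements depends only
    -- on its least element. Points are peeled off from below, and each time the induction
    -- hypothesis on `k` thins out the rest.
    have pre : ∀ m : ℕ, ∃ R : ℕ, ∀ (f : Finset ℕ → C) (S : Finset ℕ), R ≤ S.card →
        ∃ T ⊆ S, T.card = m ∧ ∃ g : ℕ → C, ∀ a ∈ T, ∀ U ⊆ T, (∀ b ∈ U, a < b) → U.card = k →
          f (insert a U) = g a := by
      intro m
      induction m with
      | zero =>
        refine ⟨0, fun f S _ => ⟨∅, Finset.empty_subset _, rfl, fun _ => f ∅, ?_⟩⟩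
        simp
      | succ m ihm =>
        obtain ⟨R₀, hR₀⟩ := ihm
        obtain ⟨R₁, hR₁⟩ := ih R₀
        refine ⟨R₁ + 1, fun f S hS => ?_⟩
        have hne : S.Nonempty := Finset.card_pos.mp (by omega)
        set a := S.min' hne with ha
        have haS : a ∈ S := S.min'_mem hne
        obtain ⟨T₁, hT₁, hT₁c, c, hc⟩ := hR₁ (fun U => f (insert a U)) (S.erase a)
          (by rw [Finset.card_erase_of_mem haS]; omega)
        obtain ⟨T₂, hT₂, hT₂c, g, hg⟩ := hR₀ f T₁ hT₁c.ge
        have hlt : ∀ b ∈ T₂, a < b := fun b hb => by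
          have := hT₁ (hT₂ hb)
          exact S.min'_lt_of_mem_erase_min' hne this
        have haT : a ∉ T₂ := fun h => lt_irrefl _ (hlt a h)
        refine ⟨insert a T₂, ?_, by rw [Finset.card_insert_of_notMem haT, hT₂c],
          Function.update g a c, ?_⟩
        · exact Finset.insert_subset haS ((hT₂.trans hT₁).trans (Finset.erase_subset _ _))
        · intro b hb U hU hbU hUc
          have hUa : U ⊆ T₂ := by
            intro x hx
            rcases Finset.mem_insert.mp (hU hx) with rfl | h
            · rcases Finset.mem_insert.mp hb with rfl | h'
              · exact absurd (hbU _ hx) (lt_irrefl _)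
              · exact absurd (hbU _ hx) (hlt _ h').not_gt
            · exact h
          rcases Finset.mem_insert.mp hb with rfl | h'
          · rw [Function.update_self]
            exact hc U (hUa.trans hT₂) hUc
          · rw [Function.update_of_ne (hlt b h').ne']
            exact hg b h' U hUa hbU hUc
    intro t
    have := Fintype.ofFinite C
    -- With more than `card C * t` points, some value of `g` is taken more than `t` times.
    obtain ⟨R, hR⟩ := pre (Fintype.card C * t + 1)
    refine ⟨R, fun f S hS => ?_⟩
    obtain ⟨T, hT, hTc, g, hg⟩ := hR f S hS
    obtain ⟨c, -, hc⟩ := Finset.exists_lt_card_fiber_of_mul_lt_card_of_maps_to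
      (s := T) (t := Finset.univ) (f := g) (n := t) (fun _ _ => Finset.mem_univ _)
      (by rw [hTc, Finset.card_univ]; omega)
    obtain ⟨T', hT', hT'c⟩ := Finset.exists_subset_card_eq hc.le
    refine ⟨T', fun x hx => hT (Finset.mem_filter.mp (hT' hx)).1, hT'c, c, fun U hU hUc => ?_⟩
    have hne : U.Nonempty := Finset.card_pos.mp (by omega)
    have hmem := U.min'_mem hne
    have h1 := Finset.mem_filter.mp (hT' (hU hmem))
    have := hg (U.min' hne) h1.1 (U.erase (U.min' hne))
      (fun x hx => (Finset.mem_filter.mp (hT' (hU (Finset.mem_of_mem_erase hx)))).1)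
      (fun b hb => U.min'_lt_of_mem_erase_min' hne hb)
      (by rw [Finset.card_erase_of_mem hmem]; omega)
    rw [Finset.insert_erase hmem] at this
    rw [this, h1.2]

theorem ramsey_family {C τ : Type*} [Finite C] (k : τ → ℕ) (f : τ → Finset ℕ → C)
    (I : Finset τ) : ∀ t : ℕ, ∃ R : ℕ, ∀ S : Finset ℕ, R ≤ S.card →
    ∃ T ⊆ S, T.card = t ∧ ∀ i ∈ I, ∃ c, ∀ U ⊆ T, U.card = k i → f i U = c := by
  classical
  induction I using Finset.induction_on with
  | empty =>
    intro t
    refine ⟨t, fun S hS => ?_⟩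
    obtain ⟨T, hT, hc⟩ := Finset.exists_subset_card_eq hS
    exact ⟨T, hT, hc, by simp⟩
  | insert i I _ ih =>
    intro t
    obtain ⟨R₀, hR₀⟩ := ramsey C (k i) t
    obtain ⟨R, hR⟩ := ih R₀
    refine ⟨R, fun S hS => ?_⟩
    obtain ⟨T, hT, hTc, h⟩ := hR S hS
    obtain ⟨T', hT', hT'c, c, hc⟩ := hR₀ (f i) T hTc.ge
    refine ⟨T', hT'.trans hT, hT'c, fun j hj => ?_⟩
    rcases Finset.mem_insert.mp hj with rfl | hj
    · exact ⟨c, hc⟩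
    · obtain ⟨c, hc⟩ := h j hj
      exact ⟨c, fun U hU => hc U (hU.trans hT')⟩

/-- Greedy extraction of disjoint sets from a large set. -/
theorem exists_disjoint_blocks {γ : Type*} {Mono : Finset ℕ → γ → Prop} {t R : ℕ}
    (hR : ∀ S : Finset ℕ, R ≤ S.card → ∃ T ⊆ S, T.card = t ∧ ∃ c, Mono T c) (q : ℕ) :
    ∀ S : Finset ℕ, q * t + R ≤ S.card → ∃ (T : Fin q → Finset ℕ) (col : Fin q → γ),
      (∀ j, (T j).card = t ∧ T j ⊆ S ∧ Mono (T j) (col j)) ∧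
      Pairwise fun i j => Disjoint (T i) (T j) := by
  classical
  induction q with
  | zero => exact fun S _ => ⟨Fin.elim0, Fin.elim0, fun j => j.elim0, fun j => j.elim0⟩
  | succ q ih =>
    intro S hS
    obtain ⟨T₀, hT₀, hT₀c, c, hc⟩ := hR S (by omega)
    obtain ⟨T, col, h, hd⟩ := ih (S \ T₀) (by
      rw [Finset.card_sdiff_of_subset hT₀, hT₀c]
      rw [Nat.succ_mul] at hS
      omega)
    have hdis : ∀ j, Disjoint T₀ (T j) := fun j =>
      (Finset.disjoint_sdiff).mono_right (h j).2.1
    refine ⟨Fin.cons T₀ T, Fin.cons c col, ?_, ?_⟩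
    · intro j
      refine Fin.cases ?_ (fun j => ?_) j
      · exact ⟨hT₀c, hT₀, hc⟩
      · exact ⟨(h j).1, (h j).2.1.trans Finset.sdiff_subset, (h j).2.2⟩
    · intro i j
      refine Fin.cases ?_ (fun i => ?_) i <;> refine Fin.cases ?_ (fun j => ?_) j
      · simp
      · intro _
        simpa using hdis j
      · intro _
        simpa using (hdis i).symm
      · intro hij
        simpa using hd (fun h => hij (by rw [h]))

/-- The colour will determine the `PO`-algorithm, whereas `t` will be the number of nodes of a lift
that is chosen later; hence the colour may not depend on `t`. A colour that occurs for infinitely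
many block sizes serves all sizes, because blocks can be shrunk. -/
theorem exists_common_colour {γ : Type*} [Finite γ] {Mono : Finset ℕ → γ → Prop}
    (hmono : ∀ T T' c, T' ⊆ T → Mono T c → Mono T' c)
    (hR : ∀ t : ℕ, ∃ R : ℕ, ∀ S : Finset ℕ, R ≤ S.card → ∃ T ⊆ S, T.card = t ∧ ∃ c, Mono T c)
    (s : ℕ → ℕ)
    (hs : Filter.Tendsto (fun n : ℕ => (s n : ℝ) / (n : ℝ)) Filter.atTop Filter.atTop) :
    ∃ c, ∀ t : ℕ, 0 < t → ∃ n : ℕ, 0 < n ∧ t ∣ n ∧ ∃ T : Fin n → Finset ℕ,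
      (∀ j, (T j).card = t ∧ T j ⊆ Finset.Icc 1 (s n) ∧ Mono (T j) c) ∧
      Pairwise fun i j => Disjoint (T i) (T j) := by
  classical
  have := Fintype.ofFinite γ
  have step : ∀ t : ℕ, ∃ (n : ℕ) (c : γ), 0 < n ∧ t.factorial ∣ n ∧ ∃ T : Fin n → Finset ℕ,
      (∀ j, (T j).card = t ∧ T j ⊆ Finset.Icc 1 (s n) ∧ Mono (T j) c) ∧
      Pairwise fun i j => Disjoint (T i) (T j) := by
    intro t
    obtain ⟨R, hR⟩ := hR t
    obtain ⟨n₀, hn₀⟩ := (Filter.tendsto_atTop.mp hs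
      (((Fintype.card γ + 1) * t + R : ℕ) : ℝ)).exists_forall_of_atTop
    -- The factorial makes `n` divisible by all positive numbers up to `t`, so that divisibility
    -- survives when the blocks are shrunk.
    set n := t.factorial * (n₀ + 1) with hn
    have hpos : 0 < n := Nat.mul_pos t.factorial_pos n₀.succ_pos
    have hle : n₀ ≤ n := by
      have : 1 * (n₀ + 1) ≤ n := Nat.mul_le_mul_right _ t.factorial_pos
      omega
    -- This is where `s n / n → ∞` enters: there is room for `(card γ + 1) * n` disjoint blocks, and
    -- `n` of these share a colour.
    have hsn : ((Fintype.card γ + 1) * t + R) * n ≤ s n := by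
      have h := hn₀ n hle
      rw [le_div_iff₀ (by exact_mod_cast hpos)] at h
      exact_mod_cast h
    obtain ⟨T, col, hT, hd⟩ := exists_disjoint_blocks hR ((Fintype.card γ + 1) * n)
      (Finset.Icc 1 (s n)) (by
        rw [Nat.card_Icc]
        have : R ≤ R * n := Nat.le_mul_of_pos_right _ hpos
        have : ((Fintype.card γ + 1) * t + R) * n
          = (Fintype.card γ + 1) * n * t + R * n := by ring
        omega)
    obtain ⟨c, -, hc⟩ := Finset.exists_lt_card_fiber_of_mul_lt_card_of_maps_to
      (s := Finset.univ) (t := Finset.univ) (f := col) (n := n) (fun _ _ => Finset.mem_univ _)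
      (by
        rw [Finset.card_univ, Finset.card_univ, Fintype.card_fin]
        exact Nat.mul_lt_mul_of_pos_right (Nat.lt_succ_self _) hpos)
    obtain ⟨J, hJ, hJc⟩ := Finset.exists_subset_card_eq hc.le
    refine ⟨n, c, hpos, Dvd.intro _ rfl, fun j => T (J.orderEmbOfFin hJc j), fun j => ?_, ?_⟩
    · have hj := (Finset.mem_filter.mp (hJ (J.orderEmbOfFin_mem hJc j))).2
      have := hT (J.orderEmbOfFin hJc j)
      rw [hj] at this
      exact this
    · intro i j hij
      exact hd fun h => hij ((J.orderEmbOfFin hJc).injective h)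
  choose n col hn hdvd hT using step
  obtain ⟨c, hc⟩ := Finite.exists_infinite_fiber col
  refine ⟨c, fun t ht => ?_⟩
  obtain ⟨k, hk, htk⟩ := (Set.infinite_coe_iff.mp hc).exists_gt t
  obtain ⟨T, hT, hd⟩ := hT k
  have hk : col k = c := hk
  have hsub : ∀ j, ∃ T' ⊆ T j, T'.card = t := fun j =>
    Finset.exists_subset_card_eq (by rw [(hT j).1]; exact htk.le)
  choose T' hT' hT'c using hsub
  refine ⟨n k, hn k, (Nat.dvd_factorial ht htk.le).trans (hdvd k), T', fun j => ?_, ?_⟩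
  · exact ⟨hT'c j, (hT' j).trans (hT j).2.1, hk ▸ hmono _ _ _ (hT' j) (hT j).2.2⟩
  · intro i j hij
    exact (hd hij).mono (hT' i) (hT' j)

/-! ### The Magnus representation of the free group -/

section Magnus

variable {L : Type} [DecidableEq L]

/-- Right multiplication by `1 + x` of a power series in non-commuting variables. A monomial is
a list of variables, the last variable first. -/
def magnusStep (x : L) (f : List L → ℤ) : List L → ℤ
  | [] => f []
  | y :: m => f (y :: m) + if y = x then f m else 0

/-- Right multiplication by `(1 + x)⁻¹`. -/
def magnusUnstep (x : L) (f : List L → ℤ) : List L → ℤ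
  | [] => f []
  | y :: m => f (y :: m) - if y = x then magnusUnstep x f m else 0

theorem magnusUnstep_magnusStep (x : L) (f : List L → ℤ) :
    magnusUnstep x (magnusStep x f) = f := by
  funext m
  induction m with
  | nil => rfl
  | cons y m ih =>
    simp only [magnusUnstep, ih, magnusStep]
    ring

theorem magnusStep_magnusUnstep (x : L) (f : List L → ℤ) :
    magnusStep x (magnusUnstep x f) = f := by
  funext m
  cases m with
  | nil => rfl
  | cons y m => simp only [magnusUnstep, magnusStep]; ring

/-- Multiplication by the letter `x` or `x⁻¹`. -/
def magnusLetter (a : L × Bool) (f : List L → ℤ) : List L → ℤ :=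
  if a.2 then magnusStep a.1 f else magnusUnstep a.1 f

def magnusAct : List (L × Bool) → (List L → ℤ) → List L → ℤ
  | [], f => f
  | a :: w, f => magnusAct w (magnusLetter a f)

theorem magnusAct_append (w w' : List (L × Bool)) (f : List L → ℤ) :
    magnusAct (w ++ w') f = magnusAct w' (magnusAct w f) := by
  induction w generalizing f with
  | nil => rfl
  | cons a w ih => exact ih _

theorem magnusLetter_cancel (x : L) (b : Bool) (f : List L → ℤ) :
    magnusLetter (x, !b) (magnusLetter (x, b) f) = f := by
  cases b
  · exact magnusStep_magnusUnstep x f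
  · exact magnusUnstep_magnusStep x f

theorem magnusAct_red {w w' : List (L × Bool)} (h : FreeGroup.Red w w') (f : List L → ℤ) :
    magnusAct w f = magnusAct w' f := by
  induction h with
  | refl => rfl
  | tail _ hs ih =>
    rw [ih]
    cases hs with
    | not => simp only [magnusAct_append, magnusAct, magnusLetter_cancel]

/-- The power series `1`. -/
def magnusOne : List L → ℤ
  | [] => 1
  | _ :: _ => 0

theorem magnusLetter_apply_of_not_head {a : L × Bool} {f : List L → ℤ} {m : List L}
    (h : ∀ y ∈ m.head?, y ≠ a.1) : magnusLetter a f m = f m := by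
  cases m with
  | nil => cases hb : a.2 <;> simp [magnusLetter, hb, magnusStep, magnusUnstep]
  | cons y m =>
    have : y ≠ a.1 := h y rfl
    cases hb : a.2 <;> simp [magnusLetter, hb, magnusStep, magnusUnstep, this]

theorem magnusLetter_apply_cons {a : L × Bool} {f : List L → ℤ} {m : List L}
    (h : ∀ y ∈ m.head?, y ≠ a.1) :
    magnusLetter a f (a.1 :: m) = f (a.1 :: m) + (if a.2 then 1 else -1) * f m := by
  cases hb : a.2
  · have := magnusLetter_apply_of_not_head (f := f) h
    simp only [magnusLetter, hb] at this
    simp only [magnusLetter, hb, Bool.false_eq_true, if_false] at this ⊢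
    simp only [magnusUnstep, if_true, this]
    ring
  · simp [magnusLetter, hb, magnusStep]

/-- A reduced nonempty word has a nonzero coefficient at the alternating monomial that has one
variable for each syllable of the word. -/
theorem exists_magnus_coeff_ne_zero (w : List (L × Bool)) (a : L × Bool)
    (hw : FreeGroup.IsReduced (w ++ [a])) :
    ∃ (m : List L) (e : ℤ), (a.1 :: m).IsChain (· ≠ ·) ∧
      magnusAct (w ++ [a]) magnusOne m ≠ 0 ∧
      magnusAct (w ++ [a]) magnusOne (a.1 :: m) = e * magnusAct (w ++ [a]) magnusOne m ∧
      0 < (if a.2 then 1 else -1) * e ∧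
      (∀ m' : List L, m'.IsChain (· ≠ ·) → (∀ y ∈ m'.head?, y ≠ a.1) → m.length ≤ m'.length →
        m' ≠ m → magnusAct (w ++ [a]) magnusOne m' = 0) ∧
      (∀ m' : List L, m'.IsChain (· ≠ ·) → m.length + 1 ≤ m'.length →
        m' ≠ a.1 :: m → magnusAct (w ++ [a]) magnusOne m' = 0) := by
  induction w using List.reverseRecOn generalizing a with
  | nil =>
    have hone : ∀ m : List L, m ≠ [] → magnusOne m = 0 := by
      intro m hm
      cases m with
      | nil => exact absurd rfl hm
      | cons => rfl
    have h0 : ∀ m' : List L, m'.IsChain (· ≠ ·) → (∀ y ∈ m'.head?, y ≠ a.1) → m' ≠ [] →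
        magnusLetter a magnusOne m' = 0 := fun m' _ hh hne => by
      rw [magnusLetter_apply_of_not_head hh, hone _ hne]
    refine ⟨[], if a.2 then 1 else -1, by simp, ?_, ?_, ?_, ?_, ?_⟩
    · simp only [List.nil_append, magnusAct]
      rw [magnusLetter_apply_of_not_head (by simp)]
      simp [magnusOne]
    · simp only [List.nil_append, magnusAct]
      rw [magnusLetter_apply_cons (by simp), magnusLetter_apply_of_not_head (by simp)]
      simp [magnusOne]
    · split_ifs <;> simp
    · intro m' hc hh _ hne
      exact h0 m' hc hh hne
    · intro m' hc hl hne
      cases m' with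
      | nil => simp at hl
      | cons y m' =>
        by_cases hy : y = a.1
        · subst hy
          have hh : ∀ z ∈ m'.head?, z ≠ a.1 := by
            intro z hz
            exact (List.isChain_cons.mp hc).1 z hz |>.symm
          simp only [List.nil_append, magnusAct]
          rw [magnusLetter_apply_cons hh, hone _ (List.cons_ne_nil _ _), hone m']
          · simp
          · rintro rfl; exact hne rfl
        · exact h0 _ hc (by simpa using hy) (List.cons_ne_nil _ _)
  | append_singleton w c ih =>
    have hwc : FreeGroup.IsReduced (w ++ [c]) := hw.infix ⟨[], [a], by simp⟩
    have hca : c.1 = a.1 → c.2 = a.2 := by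
      have : FreeGroup.IsReduced [c, a] := hw.infix ⟨w, [], by simp⟩
      simpa [FreeGroup.IsReduced] using this
    obtain ⟨m, e, hm, hp, he, hs, h2, h3⟩ := ih c hwc
    set g := magnusAct (w ++ [c]) magnusOne with hg
    have hact : magnusAct (w ++ [c] ++ [a]) magnusOne = magnusLetter a g := by
      rw [magnusAct_append]; rfl
    rw [hact]
    -- The integer `e` is the exponent of the last syllable, and `m` has one variable for each
    -- earlier syllable. A letter with the same generator prolongs the syllable: `e` moves away from
    -- 0, since no cancellation occurs in a reduced word. A new generator opens a syllable with
    -- exponent `±1`.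
    by_cases hx : a.1 = c.1
    · have hxb := hca hx.symm
      have hhead : ∀ y ∈ m.head?, y ≠ a.1 := fun y hy =>
        hx ▸ ((List.isChain_cons.mp hm).1 y hy).symm
      refine ⟨m, e + (if a.2 then 1 else -1), hx ▸ hm, ?_, ?_, ?_, ?_, ?_⟩
      · rwa [magnusLetter_apply_of_not_head hhead]
      · rw [magnusLetter_apply_cons hhead, magnusLetter_apply_of_not_head hhead, hx, he]
        ring
      · rw [← hxb]
        split_ifs at hs ⊢ <;> omega
      · intro m' hc hh hl hne
        rw [magnusLetter_apply_of_not_head hh]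
        exact h2 m' hc (hx ▸ hh) hl hne
      · intro m' hc hl hne
        cases m' with
        | nil => simp at hl
        | cons y m' =>
          by_cases hy : y = a.1
          · subst hy
            have hh : ∀ z ∈ m'.head?, z ≠ a.1 := fun z hz =>
              ((List.isChain_cons.mp hc).1 z hz).symm
            rw [magnusLetter_apply_cons hh, h3 _ hc hl (hx ▸ hne),
              h2 m' (List.isChain_cons.mp hc).2 (hx ▸ hh) (by simpa using hl)
                (fun h => hne (by rw [h]))]
            simp
          · rw [magnusLetter_apply_of_not_head (by simpa using hy)]
            exact h3 _ hc hl (hx ▸ hne)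
    · have hhead : ∀ y ∈ (c.1 :: m).head?, y ≠ a.1 := by
        simpa using fun h => hx h.symm
      have hg0 : g (c.1 :: m) ≠ 0 := by
        rw [he]
        refine mul_ne_zero ?_ hp
        rintro rfl
        simp at hs
      have hchain : (a.1 :: c.1 :: m).IsChain (· ≠ ·) := List.isChain_cons_cons.mpr ⟨hx, hm⟩
      refine ⟨c.1 :: m, if a.2 then 1 else -1, hchain, ?_, ?_, ?_, ?_, ?_⟩
      · rwa [magnusLetter_apply_of_not_head hhead]
      · rw [magnusLetter_apply_cons hhead, magnusLetter_apply_of_not_head hhead,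
          h3 (a.1 :: c.1 :: m) hchain (by simp) (by
            intro h
            have := congrArg List.length h
            simp at this)]
        simp
      · split_ifs <;> simp
      · intro m' hc hh hl hne
        rw [magnusLetter_apply_of_not_head hh]
        exact h3 m' hc (by simpa using hl) hne
      · intro m' hc hl hne
        cases m' with
        | nil => simp at hl
        | cons y m' =>
          have hgm : g (y :: m') = 0 := h3 _ hc (by simp at hl ⊢; omega) (by
            intro h
            have := congrArg List.length h
            simp at this hl
            omega)
          by_cases hy : y = a.1
          · subst hy
            have hh : ∀ z ∈ m'.head?, z ≠ a.1 := fun z hz =>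
              ((List.isChain_cons.mp hc).1 z hz).symm
            rw [magnusLetter_apply_cons hh, hgm,
              h3 m' (List.isChain_cons.mp hc).2 (by simp at hl ⊢; omega)
                (fun h => hne (by rw [h]))]
            simp
          · rw [magnusLetter_apply_of_not_head (by simpa using hy), hgm]

/-- The Magnus representation of the free group is faithful. -/
theorem magnusAct_injective {w w' : List (L × Bool)} (hw : FreeGroup.IsReduced w)
    (hw' : FreeGroup.IsReduced w') (h : magnusAct w magnusOne = magnusAct w' magnusOne) :
    w = w' := by
  have h1 : magnusAct (FreeGroup.reduce (w ++ FreeGroup.invRev w')) magnusOne = magnusOne := by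
    rw [← magnusAct_red FreeGroup.reduce.red, magnusAct_append, h, ← magnusAct_append,
      magnusAct_red (w' := [])]
    · rfl
    · have := FreeGroup.reduce_invRev_left_cancel (L := FreeGroup.invRev w')
      rw [FreeGroup.invRev_invRev] at this
      exact this ▸ FreeGroup.reduce.red
  have h2 : FreeGroup.reduce (w ++ FreeGroup.invRev w') = [] := by
    rcases List.eq_nil_or_concat (FreeGroup.reduce (w ++ FreeGroup.invRev w')) with h0 | ⟨u, a, hu⟩
    · exact h0
    · exfalso
      rw [List.concat_eq_append] at hu
      -- A nonempty reduced word has a nonzero coefficient at a nonempty monomial, where the series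
      -- `1` has coefficient 0.
      obtain ⟨m, e, -, hp, he, hs, -, -⟩ := exists_magnus_coeff_ne_zero u a
        (hu ▸ .of_reduce_eq FreeGroup.reduce.idem)
      rw [← hu, h1] at he hp
      have : e * magnusOne m = 0 := he.symm
      rcases mul_eq_zero.mp this with rfl | h
      · simp at hs
      · exact hp h
  have h3 : FreeGroup.mk w = FreeGroup.mk w' := by
    rw [← mul_inv_eq_one, FreeGroup.inv_mk, FreeGroup.mul_mk, ← FreeGroup.reduce.self, h2]
    rfl
  have := FreeGroup.reduce.sound h3
  rwa [hw.reduce_eq, hw'.reduce_eq] at this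

end Magnus

/-! ### Products of power series, truncation and the lexicographic order -/

section Magnus

variable {L : Type}

/-- The coefficient of `m` in the product `f * h`. -/
def magnusConv (f : List L → ℤ) : List L → (List L → ℤ) → ℤ
  | [], h => h [] * f []
  | y :: m, h => h [] * f (y :: m) + magnusConv f m fun q => h (y :: q)

theorem magnusConv_add (f : List L → ℤ) (m : List L) (h h' : List L → ℤ) :
    magnusConv f m (h + h') = magnusConv f m h + magnusConv f m h' := by
  induction m generalizing h h' with
  | nil => simp [magnusConv]; ring
  | cons y m ih =>
    have := ih (fun q => h (y :: q)) (fun q => h' (y :: q))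
    simp only [magnusConv, Pi.add_apply] at this ⊢
    rw [show (fun q => h (y :: q) + h' (y :: q)) = (fun q => h (y :: q)) + fun q => h' (y :: q)
      from rfl, this]
    ring

theorem magnusConv_neg (f : List L → ℤ) (m : List L) (h : List L → ℤ) :
    magnusConv f m (-h) = -magnusConv f m h := by
  induction m generalizing h with
  | nil => simp [magnusConv]
  | cons y m ih =>
    have := ih fun q => h (y :: q)
    simp only [magnusConv, Pi.neg_apply] at this ⊢
    rw [show (fun q => -h (y :: q)) = -(fun q => h (y :: q)) from rfl, this]
    ring

theorem magnusConv_sub (f : List L → ℤ) (m : List L) (h h' : List L → ℤ) :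
    magnusConv f m (h - h') = magnusConv f m h - magnusConv f m h' := by
  rw [sub_eq_add_neg, magnusConv_add, magnusConv_neg, sub_eq_add_neg]

/-- Of all ways to split `m` between the two factors, only the one that assigns the whole of `m` to
`h` contributes. -/
theorem magnusConv_eq_of_forall (f : List L → ℤ) (m : List L) (h : List L → ℤ)
    (hh : ∀ q : List L, q.Sublist m → q.length < m.length → h q = 0) :
    magnusConv f m h = h m * f [] := by
  induction m generalizing h with
  | nil => rfl
  | cons y m ih =>
    rw [magnusConv, hh [] (List.nil_sublist _) (by simp),
      ih _ fun q hq hl => hh _ (hq.cons_cons y) (by simpa using hl)]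
    ring

theorem magnusConv_one (f : List L → ℤ) (m : List L) : magnusConv f m magnusOne = f m := by
  cases m with
  | nil => simp [magnusConv, magnusOne]
  | cons y m =>
    rw [magnusConv, magnusConv_eq_of_forall f m (fun q => magnusOne (y :: q)) fun _ _ _ => rfl]
    simp [magnusOne]

theorem extend_comp_of_injective {L : Type} {n : ℕ} {e : Fin n → List L}
    (he : Function.Injective e) (g : Fin n → ℤ) :
    Function.extend e g 0 ∘ e = g := funext fun i => he.extend_apply _ _ i

variable [DecidableEq L]

theorem magnusConv_magnusStep (f : List L → ℤ) (x : L) (h : List L → ℤ) :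
    (fun m => magnusConv f m (magnusStep x h)) = magnusStep x fun m => magnusConv f m h := by
  funext m
  cases m with
  | nil => rfl
  | cons y m =>
    simp only [magnusStep, magnusConv]
    by_cases hy : y = x
    · simp only [hy, if_true]
      have := magnusConv_add f m (fun q => h (x :: q)) h
      rw [show (fun q => h (x :: q) + h q) = (fun q => h (x :: q)) + h from rfl, this]
      ring
    · simp [hy]

theorem magnusConv_magnusLetter (f : List L → ℤ) (a : L × Bool) (h : List L → ℤ) :
    (fun m => magnusConv f m (magnusLetter a h)) =
      magnusLetter a fun m => magnusConv f m h := by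
  cases hb : a.2
  · simp only [magnusLetter, hb, Bool.false_eq_true, if_false]
    rw [← magnusUnstep_magnusStep a.1 fun m => magnusConv f m (magnusUnstep a.1 h),
      ← magnusConv_magnusStep, magnusStep_magnusUnstep]
  · simp only [magnusLetter, hb, if_true]
    exact magnusConv_magnusStep f a.1 h

/-- Letters multiply on the right and thus commute with left multiplication by `f`. -/
theorem magnusAct_eq_magnusConv (w : List (L × Bool)) (f : List L → ℤ) (m : List L) :
    magnusAct w f m = magnusConv f m (magnusAct w magnusOne) := by
  have : ∀ h : List L → ℤ, (fun m => magnusConv f m (magnusAct w h)) =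
      magnusAct w fun m => magnusConv f m h := by
    induction w with
    | nil => exact fun _ => rfl
    | cons a w ih =>
      intro h
      rw [magnusAct, magnusAct, ih, magnusConv_magnusLetter]
  have h1 := congrFun (this magnusOne) m
  simp only [magnusConv_one] at h1
  exact h1.symm

omit [DecidableEq L] in
theorem abs_magnusConv_le {f h : List L → ℤ} {C N : ℤ} (hN : 1 ≤ N) (hC : 0 ≤ C) (m : List L)
    (hh : ∀ q : List L, q.Sublist m → |h q| ≤ C)
    (hf : ∀ q : List L, q.Sublist m → |f q| ≤ N ^ q.length) :
    |magnusConv f m h| ≤ (m.length + 1) * C * N ^ m.length := by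
  induction m generalizing h with
  | nil =>
    have h1 := hh [] (List.Sublist.refl _)
    have h2 := hf [] (List.Sublist.refl _)
    simp only [magnusConv, abs_mul, List.length_nil, pow_zero] at h2 ⊢
    simpa using mul_le_mul h1 h2 (abs_nonneg _) hC
  | cons y m ih =>
    have h1 := hh [] (List.nil_sublist _)
    have h2 := hf (y :: m) (List.Sublist.refl _)
    have h3 := ih (h := fun q => h (y :: q)) (fun q hq => hh _ (hq.cons_cons y))
      (fun q hq => hf q (hq.cons y))
    rw [magnusConv]
    calc |h [] * f (y :: m) + magnusConv f m fun q => h (y :: q)|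
        ≤ |h []| * |f (y :: m)| + |magnusConv f m fun q => h (y :: q)| := by
          rw [← abs_mul]; exact abs_add_le _ _
      _ ≤ C * N ^ (y :: m).length + (m.length + 1) * C * N ^ m.length :=
          add_le_add (mul_le_mul h1 h2 (abs_nonneg _) hC) h3
      _ ≤ C * N ^ (y :: m).length + (m.length + 1) * C * N ^ (y :: m).length := by
          gcongr
          · simp
      _ = _ := by push_cast [List.length_cons]; ring

omit [DecidableEq L] in
-- Without a constant term in `h`, only coefficients of `f` at strictly shorter monomials occur. The
-- power of `N` that is saved makes the boundary effect in the box negligible.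
theorem abs_magnusConv_le_of_nil {f h : List L → ℤ} {C N : ℤ} (hN : 1 ≤ N) (hC : 0 ≤ C)
    (m : List L) (h0 : h [] = 0) (hh : ∀ q : List L, q.Sublist m → |h q| ≤ C)
    (hf : ∀ q : List L, q.Sublist m → |f q| ≤ N ^ q.length) :
    |magnusConv f m h| ≤ m.length * C * N ^ (m.length - 1) := by
  cases m with
  | nil => simp [magnusConv, h0]
  | cons y m =>
    rw [magnusConv, h0]
    simpa using abs_magnusConv_le hN hC m (h := fun q => h (y :: q))
      (fun q hq => hh _ (hq.cons_cons y)) fun q hq => hf q (hq.cons y)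

theorem magnusAct_nil (w : List (L × Bool)) (f : List L → ℤ) : magnusAct w f [] = f [] := by
  induction w generalizing f with
  | nil => rfl
  | cons a w ih => rw [magnusAct, ih, magnusLetter_apply_of_not_head (by simp)]

/-- The coefficient of `m` in a product with a letter depends only on the coefficients of
submonomials of `m`. -/
theorem magnusLetter_congr (a : L × Bool) {f f' : List L → ℤ} {m : List L}
    (h : ∀ q : List L, q.Sublist m → f q = f' q) : magnusLetter a f m = magnusLetter a f' m := by
  induction m with
  | nil =>
    rw [magnusLetter_apply_of_not_head (by simp), magnusLetter_apply_of_not_head (by simp),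
      h _ (List.Sublist.refl _)]
  | cons y m ih =>
    have ih := ih fun q hq => h q (hq.cons y)
    have h1 := h _ (List.Sublist.refl _)
    have h2 := h _ (List.sublist_cons_self y m)
    cases hb : a.2
    · simp only [magnusLetter, hb, Bool.false_eq_true, if_false] at ih ⊢
      simp only [magnusUnstep, ih, h1]
    · simp only [magnusLetter, hb, if_true, magnusStep, h1, h2]

/-! ### Truncation to finitely many monomials -/

section Truncation

variable {n : ℕ} {e : Fin n → List L}

/-- Closure under submonomials makes the action descend to truncated series. -/
theorem magnusAct_congr (hsub : ∀ i q, q.Sublist (e i) → ∃ j, e j = q) (w : List (L × Bool))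
    {f f' : List L → ℤ} (h : f ∘ e = f' ∘ e) : magnusAct w f ∘ e = magnusAct w f' ∘ e := by
  induction w generalizing f f' with
  | nil => exact h
  | cons a w ih =>
    refine ih (funext fun i => magnusLetter_congr a fun q hq => ?_)
    obtain ⟨j, rfl⟩ := hsub i q hq
    exact congrFun h j

/-- Multiplication by a letter, truncated to the monomials in the range of `e`. -/
noncomputable def truncLetter (e : Fin n → List L) (a : L × Bool) (g : Fin n → ℤ) : Fin n → ℤ :=
  magnusLetter a (Function.extend e g 0) ∘ e

theorem truncLetter_cancel (he : Function.Injective e)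
    (hsub : ∀ i q, q.Sublist (e i) → ∃ j, e j = q) (x : L) (b : Bool) (g : Fin n → ℤ) :
    truncLetter e (x, !b) (truncLetter e (x, b) g) = g := by
  have := magnusAct_congr hsub [(x, !b)] (extend_comp_of_injective he (truncLetter e (x, b) g))
  simp only [magnusAct] at this
  rw [truncLetter, this, magnusLetter_cancel, extend_comp_of_injective he]

/-- Run a word of letters through a family of permutations. -/
def runPerm {M D : Type} (π : M → Equiv.Perm D) : List (M × Bool) → D → D
  | [], g => g
  | a :: w, g => runPerm π w (if a.2 then π a.1 g else (π a.1).symm g)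

/-- The partial action of the letters on a finite set extends to permutations. -/
theorem exists_perm_extending (he : Function.Injective e)
    (hsub : ∀ i q, q.Sublist (e i) → ∃ j, e j = q) (box : Finset (Fin n → ℤ)) :
    ∃ π : L → Equiv.Perm box, ∀ (w : List (L × Bool)) (g : box),
      (∀ p, p <+: w → magnusAct p (Function.extend e g.1 0) ∘ e ∈ box) →
      (runPerm π w g).1 = magnusAct w (Function.extend e g.1 0) ∘ e := by
  classical
  have hext : ∀ x : L, ∃ σ : Equiv.Perm box, ∀ g : box, truncLetter e (x, true) g.1 ∈ box →
      (σ g).1 = truncLetter e (x, true) g.1 := by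
    intro x
    -- A letter maps the points that it keeps in the box bijectively onto those that its inverse
    -- keeps in the box; a bijection between subsets of a finite set extends to a permutation.
    let E : {g : box // truncLetter e (x, true) g.1 ∈ box} ≃
        {g : box // truncLetter e (x, false) g.1 ∈ box} :=
      { toFun := fun g => ⟨⟨_, g.2⟩, by
          have := truncLetter_cancel he hsub x true g.1.1
          simp only [Bool.not_true] at this
          simp only [this, g.1.2]⟩
        invFun := fun g => ⟨⟨_, g.2⟩, by
          have := truncLetter_cancel he hsub x false g.1.1
          simp only [Bool.not_false] at this
          simp only [this, g.1.2]⟩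
        left_inv := fun g => Subtype.ext (Subtype.ext (truncLetter_cancel he hsub x true g.1.1))
        right_inv := fun g => Subtype.ext (Subtype.ext (truncLetter_cancel he hsub x false g.1.1)) }
    refine ⟨E.extendSubtype, fun g hg => ?_⟩
    rw [Equiv.extendSubtype_apply_of_mem E g hg]
    rfl
  choose π hπ using hext
  refine ⟨π, fun w => ?_⟩
  induction w with
  | nil => exact fun g _ => (extend_comp_of_injective he g.1).symm
  | cons a w ih =>
    intro g hg
    have hmem : truncLetter e a g.1 ∈ box := hg [a] (by simp)
    have hone : (if a.2 then π a.1 g else (π a.1).symm g) = ⟨truncLetter e a g.1, hmem⟩ := by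
      obtain ⟨x, b⟩ := a
      cases b
      · simp only [Bool.false_eq_true, if_false]
        rw [Equiv.symm_apply_eq]
        have hc := truncLetter_cancel he hsub x false g.1
        simp only [Bool.not_false] at hc
        refine Subtype.ext ?_
        rw [hπ x ⟨truncLetter e (x, false) g.1, hmem⟩ (by rw [hc]; exact g.2), hc]
      · exact Subtype.ext (hπ x g hmem)
    have hact : ∀ p, magnusAct p (Function.extend e (truncLetter e a g.1) 0) ∘ e =
        magnusAct (a :: p) (Function.extend e g.1 0) ∘ e := fun p =>
      magnusAct_congr hsub p (extend_comp_of_injective he _)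
    rw [runPerm, hone, ih _ fun p hp => ?_, hact]
    rw [hact]
    exact hg _ (List.prefix_cons_inj a |>.mpr hp)

/-- Left multiplication preserves the lexicographic order. -/
theorem toLex_magnusAct_lt (hlen : Monotone (List.length ∘ e))
    (hsub : ∀ i q, q.Sublist (e i) → ∃ j, e j = q) {w w' : List (L × Bool)} {f : List L → ℤ}
    (hf : f [] = 1)
    (h : toLex (magnusAct w magnusOne ∘ e) < toLex (magnusAct w' magnusOne ∘ e)) :
    toLex (magnusAct w f ∘ e) < toLex (magnusAct w' f ∘ e) := by
  obtain ⟨i, hi, hlt⟩ := h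
  simp only [Function.comp_apply, Pi.toLex_apply] at hi hlt
  -- The difference is `f` times the difference of the series of the two words. At `e k` all proper
  -- submonomials come earlier than `i`, where that difference vanishes, so only the constant term 1
  -- of `f` acts on it.
  have key : ∀ k, k ≤ i → magnusAct w f (e k) - magnusAct w' f (e k) =
      magnusAct w magnusOne (e k) - magnusAct w' magnusOne (e k) := by
    intro k hk
    rw [magnusAct_eq_magnusConv w, magnusAct_eq_magnusConv w', ← magnusConv_sub,
      magnusConv_eq_of_forall, hf, mul_one]
    · rfl
    · intro q hq hl
      obtain ⟨j, rfl⟩ := hsub k q hq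
      have : j < k := by
        by_contra hjk
        exact absurd (hlen (not_lt.mp hjk)) (not_le.mpr hl)
      rw [Pi.sub_apply, hi j (this.trans_le hk), sub_self]
  refine ⟨i, fun j hj => ?_, ?_⟩
  · have := key j hj.le
    rw [hi j hj, sub_self, sub_eq_zero] at this
    exact this
  · have := key i le_rfl
    show magnusAct w f (e i) < magnusAct w' f (e i)
    omega

theorem magnusAct_comp_eq (hsub : ∀ i q, q.Sublist (e i) → ∃ j, e j = q)
    {w w' : List (L × Bool)} {f : List L → ℤ}
    (h : magnusAct w magnusOne ∘ e = magnusAct w' magnusOne ∘ e) :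
    magnusAct w f ∘ e = magnusAct w' f ∘ e := by
  funext k
  rw [Function.comp_apply, Function.comp_apply, ← sub_eq_zero, magnusAct_eq_magnusConv w,
    magnusAct_eq_magnusConv w', ← magnusConv_sub, magnusConv_eq_of_forall, Pi.sub_apply,
    show magnusAct w magnusOne (e k) = magnusAct w' magnusOne (e k) from congrFun h k]
  · ring
  · intro q hq _
    obtain ⟨j, rfl⟩ := hsub k q hq
    rw [Pi.sub_apply, sub_eq_zero]
    exact congrFun h j

theorem toLex_magnusAct_lt_iff (hlen : Monotone (List.length ∘ e))
    (hsub : ∀ i q, q.Sublist (e i) → ∃ j, e j = q) {w w' : List (L × Bool)} {f : List L → ℤ}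
    (hf : f [] = 1) :
    toLex (magnusAct w magnusOne ∘ e) < toLex (magnusAct w' magnusOne ∘ e) ↔
      toLex (magnusAct w f ∘ e) < toLex (magnusAct w' f ∘ e) := by
  refine ⟨toLex_magnusAct_lt hlen hsub hf, fun h => ?_⟩
  rcases lt_trichotomy (toLex (magnusAct w magnusOne ∘ e)) (toLex (magnusAct w' magnusOne ∘ e))
    with h' | h' | h'
  · exact h'
  · exact absurd (congrArg toLex (magnusAct_comp_eq hsub (f := f) (toLex_inj.mp h'))) h.ne
  · exact absurd (toLex_magnusAct_lt hlen hsub hf h') h.not_gt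

end Truncation

end Magnus

/-! ### Counting in boxes, and homogeneous permutations -/

theorem exists_length_monotone_enumeration {L : Type} (I : Finset (List L)) :
    ∃ (n : ℕ) (e : Fin n → List L), Function.Injective e ∧ Monotone (List.length ∘ e) ∧
      ∀ m, m ∈ I ↔ ∃ j, e j = m := by
  let φ := I.equivFin.symm
  let σ := Tuple.sort fun j => (φ j).1.length
  refine ⟨I.card, fun j => (φ (σ j)).1, ?_, ?_, fun m => ⟨fun hm => ?_, ?_⟩⟩
  · exact Subtype.val_injective.comp (φ.injective.comp σ.injective)
  · exact Tuple.monotone_sort fun j => (φ j).1.length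
  · exact ⟨σ.symm (φ.symm ⟨m, hm⟩), by simp⟩
  · rintro ⟨j, rfl⟩
    exact (φ (σ j)).2

/-- Two margins of width `l * C * k ^ (l - 1)` are cut from an interval with `k ^ l` points, hence
at most a fraction `2 * A / k` of it. -/
theorem card_inner_interval_ge {A C : ℤ} {k l : ℕ} (hk : 0 < k) (hA : l * C ≤ A) :
    (1 + -(2 * A / k) : ℝ) * ((Finset.Icc (1 : ℤ) ((k : ℤ) ^ l)).card : ℝ) ≤
      ((Finset.Icc (1 + l * C * (k : ℤ) ^ (l - 1)) ((k : ℤ) ^ l - l * C * (k : ℤ) ^ (l - 1))).card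
        : ℝ) := by
  have hk0 : (0 : ℝ) < k := by exact_mod_cast hk
  have hA' : ((l * C : ℤ) : ℝ) ≤ A := by exact_mod_cast hA
  have hcard : ((Finset.Icc (1 : ℤ) ((k : ℤ) ^ l)).card : ℝ) = (k : ℝ) ^ l := by
    rw [Int.card_Icc, add_sub_cancel_right, ← Nat.cast_pow, Int.toNat_natCast, Nat.cast_pow]
  rw [hcard, Int.card_Icc]
  set E : ℤ := l * C * (k : ℤ) ^ (l - 1) with hE
  have hEk : (E : ℝ) * k ≤ A * (k : ℝ) ^ l := by
    -- For `l = 0` the subtraction in `l - 1` is truncated, but the margin is 0.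
    rcases Nat.eq_zero_or_pos l with h0 | h0
    · have hE0 : E = 0 := by rw [hE, h0]; simp
      have hA0 : (0 : ℝ) ≤ A := by
        rw [h0] at hA'
        simpa using hA'
      rw [hE0, Int.cast_zero, zero_mul]
      exact mul_nonneg hA0 (pow_nonneg hk0.le _)
    · have h1 : (E : ℝ) * k = ((l * C : ℤ) : ℝ) * (k : ℝ) ^ l := by
        rw [hE, Int.cast_mul, Int.cast_pow, Int.cast_natCast, mul_assoc, ← pow_succ,
          Nat.sub_add_cancel h0]
      rw [h1]
      exact mul_le_mul_of_nonneg_right hA' (pow_nonneg hk0.le _)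
  have hle : (((k : ℤ) ^ l - E + 1 - (1 + E) : ℤ) : ℝ) ≤
      (((k : ℤ) ^ l - E + 1 - (1 + E)).toNat : ℝ) := by
    exact_mod_cast Int.self_le_toNat _
  refine le_trans ?_ hle
  have h3 : (E : ℝ) ≤ A / k * (k : ℝ) ^ l := by
    rw [div_mul_eq_mul_div, le_div_iff₀ hk0]
    exact hEk
  have h2 : (1 + -(2 * (A : ℝ) / k)) * (k : ℝ) ^ l =
    (k : ℝ) ^ l - 2 * (A / k * (k : ℝ) ^ l) := by ring
  rw [h2]
  push_cast
  linarith

theorem card_inner_box_ge {n : ℕ} (l : Fin n → ℕ) {C : ℤ} (hC : 0 ≤ C) {ε : ℝ} (hε : 0 < ε) :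
    ∃ N : ℤ, 1 ≤ N ∧
      (1 - ε) * ((Fintype.piFinset fun i => Finset.Icc 1 (N ^ l i)).card : ℝ) ≤
        ((Fintype.piFinset fun i =>
          Finset.Icc (1 + l i * C * N ^ (l i - 1)) (N ^ l i - l i * C * N ^ (l i - 1))).card
          : ℝ) := by
  set A : ℤ := ∑ i, l i * C with hA
  have hA0 : 0 ≤ A := Finset.sum_nonneg fun i _ => by positivity
  have hAi : ∀ i, l i * C ≤ A := fun i =>
    Finset.single_le_sum (f := fun i => (l i : ℤ) * C) (fun i _ => by positivity)
      (Finset.mem_univ i)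
  -- The three summands give, in this order, `a ≥ -1` below, `n * a ≥ -ε` for Bernoulli's
  -- inequality, and `k ≥ 1`.
  obtain ⟨k, hk⟩ := exists_nat_ge (2 * (A : ℝ) + n * (2 * A) / ε + 1)
  have hA0' : (0 : ℝ) ≤ A := by exact_mod_cast hA0
  have hpos : 0 ≤ n * (2 * (A : ℝ)) / ε := by positivity
  have hk1 : (1 : ℝ) ≤ k := by linarith
  have hk0 : (0 : ℝ) < k := by linarith
  refine ⟨k, by exact_mod_cast hk1, ?_⟩
  set a : ℝ := -(2 * A / k) with ha
  have ha1 : -1 ≤ a := by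
    rw [ha, neg_le_neg_iff, div_le_one hk0]
    linarith
  have hna : 1 - ε ≤ 1 + n * a := by
    have : n * (2 * (A : ℝ)) / ε ≤ k := by linarith
    rw [div_le_iff₀ hε] at this
    have h2 : n * (2 * (A : ℝ)) / k ≤ ε := by
      rw [div_le_iff₀ hk0]
      linarith
    rw [ha, mul_neg, ← mul_div_assoc]
    linarith
  have hbern := one_add_mul_le_pow (show -2 ≤ a by linarith) n
  rw [Fintype.card_piFinset, Fintype.card_piFinset, Nat.cast_prod, Nat.cast_prod]
  refine (mul_le_mul_of_nonneg_right (hna.trans hbern)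
    (Finset.prod_nonneg fun i _ => Nat.cast_nonneg _)).trans ?_
  have hpow : (1 + a) ^ n = ∏ _i : Fin n, (1 + a) := by
    rw [Finset.prod_const, Finset.card_univ, Fintype.card_fin]
  rw [hpow, ← Finset.prod_mul_distrib]
  exact Finset.prod_le_prod (fun i _ => mul_nonneg (by linarith) (Nat.cast_nonneg _))
    fun i _ => card_inner_interval_ge (by exact_mod_cast hk0) (hAi i)

section Magnus

variable {L : Type} [DecidableEq L] {n : ℕ} {e : Fin n → List L}

/-- A word `w` changes the series `g` by `g * (w - 1)`, and `w - 1` has no constant term; the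
resulting bound on the change at a monomial is exactly the margin of the inner box. -/
theorem magnusAct_mem_box (he : Function.Injective e)
    (hsub : ∀ i q, q.Sublist (e i) → ∃ j, e j = q) {w : List (L × Bool)} {C N : ℤ}
    (hC : 0 ≤ C) (hN : 1 ≤ N)
    (hw : ∀ i, |magnusAct w magnusOne (e i) - magnusOne (e i)| ≤ C) {g : Fin n → ℤ}
    (hg : ∀ i, g i ∈ Finset.Icc (1 + (e i).length * C * N ^ ((e i).length - 1))
      (N ^ (e i).length - (e i).length * C * N ^ ((e i).length - 1))) (i : Fin n) :
    magnusAct w (Function.extend e g 0) (e i) ∈ Finset.Icc 1 (N ^ (e i).length) := by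
  have hE : ∀ j, 0 ≤ (e j).length * C * N ^ ((e j).length - 1) := fun j => by positivity
  have hconv : magnusAct w (Function.extend e g 0) (e i) = g i +
      magnusConv (Function.extend e g 0) (e i) (magnusAct w magnusOne - magnusOne) := by
    rw [magnusConv_sub, ← magnusAct_eq_magnusConv, magnusConv_one, he.extend_apply]
    ring
  have habs := abs_magnusConv_le_of_nil (f := Function.extend e g 0)
    (h := magnusAct w magnusOne - magnusOne) hN hC (e i)
    (by rw [Pi.sub_apply, magnusAct_nil, sub_self])
    (fun q hq => by
      obtain ⟨j, rfl⟩ := hsub i q hq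
      exact hw j)
    (fun q hq => by
      obtain ⟨j, rfl⟩ := hsub i q hq
      rw [he.extend_apply]
      have := Finset.mem_Icc.mp (hg j)
      have := hE j
      rw [abs_of_nonneg (by omega)]
      omega)
  have := Finset.mem_Icc.mp (hg i)
  have := abs_le.mp habs
  rw [hconv, Finset.mem_Icc]
  omega

/-- For every finite set of reduced words, closed under prefixes, there is an ordering of it such
that the following holds: there are permutations, one for each generator, of finite ordered sets,
such that for all but an arbitrarily small fraction of the points the map from words to the points
of the orbit is injective and preserves the ordering. -/
theorem exists_homogeneous_perms (B : Finset (List (L × Bool)))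
    (hred : ∀ w ∈ B, FreeGroup.IsReduced w) (hpre : ∀ w ∈ B, ∀ p, p <+: w → p ∈ B) :
    ∃ lt : List (L × Bool) → List (L × Bool) → Prop, ∀ ε : ℝ, 0 < ε →
      ∃ (D : Type) (_ : Fintype D) (_ : LinearOrder D) (π : L → Equiv.Perm D) (good : Finset D),
        0 < Fintype.card D ∧ (1 - ε) * (Fintype.card D : ℝ) ≤ good.card ∧
        ∀ g ∈ good, ∀ w ∈ B, ∀ w' ∈ B, (lt w w' ↔ runPerm π w g < runPerm π w' g) ∧
          (runPerm π w g = runPerm π w' g → w = w') := by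
  have hsep : ∀ w w' : List (L × Bool), ∃ m : List L, w ∈ B → w' ∈ B →
      magnusAct w magnusOne m = magnusAct w' magnusOne m → w = w' := by
    intro w w'
    by_contra! hne
    have hww' := (hne []).2.2.2
    exact hww' (magnusAct_injective (hred _ (hne []).1) (hred _ (hne []).2.1)
      (funext fun m => (hne m).2.2.1))
  choose sep hsep using hsep
  -- One separating monomial for each pair of words, together with all submonomials; the empty
  -- monomial is included to control the constant term. None of this depends on `ε`, so neither does
  -- the order.
  obtain ⟨n, e, he, hlen, hmem⟩ := exists_length_monotone_enumeration
    (insert [] (B.biUnion fun w => B.biUnion fun w' => (sep w w').sublists.toFinset))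
  have hsub : ∀ i q, q.Sublist (e i) → ∃ j, e j = q := by
    intro i q hq
    rw [← hmem]
    have := (hmem (e i)).mpr ⟨i, rfl⟩
    simp only [Finset.mem_insert, Finset.mem_biUnion, List.mem_toFinset, List.mem_sublists]
      at this ⊢
    rcases this with h | ⟨w, hw, w', hw', h⟩
    · rw [h] at hq
      exact Or.inl (List.sublist_nil.mp hq)
    · exact Or.inr ⟨w, hw, w', hw', hq.trans h⟩
  obtain ⟨i₀, hi₀⟩ := (hmem []).mp (Finset.mem_insert_self _ _)
  refine ⟨fun w w' => toLex (magnusAct w magnusOne ∘ e) < toLex (magnusAct w' magnusOne ∘ e),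
    fun ε hε => ?_⟩
  set C : ℤ := ∑ w ∈ B, ∑ i, |magnusAct w magnusOne (e i) - magnusOne (e i)| with hCdef
  have hC : 0 ≤ C := Finset.sum_nonneg fun w _ => Finset.sum_nonneg fun i _ => abs_nonneg _
  have hCw : ∀ w ∈ B, ∀ i, |magnusAct w magnusOne (e i) - magnusOne (e i)| ≤ C := fun w hw i =>
    (Finset.single_le_sum (f := fun i => |magnusAct w magnusOne (e i) - magnusOne (e i)|)
      (fun i _ => abs_nonneg _) (Finset.mem_univ i)).trans
    (Finset.single_le_sum (f := fun w => ∑ i, |magnusAct w magnusOne (e i) - magnusOne (e i)|)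
      (fun w _ => Finset.sum_nonneg fun i _ => abs_nonneg _) hw)
  obtain ⟨N, hN, hcard⟩ := card_inner_box_ge (fun i => (e i).length) hC hε
  set box := Fintype.piFinset fun i => Finset.Icc 1 (N ^ (e i).length) with hbox
  set inner := Fintype.piFinset fun i =>
    Finset.Icc (1 + (e i).length * C * N ^ ((e i).length - 1))
      (N ^ (e i).length - (e i).length * C * N ^ ((e i).length - 1)) with hinner
  have hsubset : inner ⊆ box := by
    refine Fintype.piFinset_subset _ _ fun i => Finset.Icc_subset_Icc ?_ ?_
    · have : 0 ≤ (e i).length * C * N ^ ((e i).length - 1) := by positivity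
      omega
    · have : 0 ≤ (e i).length * C * N ^ ((e i).length - 1) := by positivity
      omega
  obtain ⟨π, hπ⟩ := exists_perm_extending he hsub box
  let ord : LinearOrder box := LinearOrder.lift' (fun g : box => toLex g.1)
    (toLex.injective.comp Subtype.val_injective)
  refine ⟨box, inferInstance, ord, π, inner.subtype (· ∈ box), ?_, ?_, ?_⟩
  · rw [Fintype.card_coe, Finset.card_pos]
    exact ⟨fun _ => 1, Fintype.mem_piFinset.mpr fun i =>
      Finset.mem_Icc.mpr ⟨le_rfl, one_le_pow₀ hN⟩⟩
  · rw [Fintype.card_coe, Finset.card_subtype, Finset.filter_true_of_mem fun g hg => hsubset hg]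
    exact hcard
  · intro g hg w hw w' hw'
    have hg : ∀ i, _ := Fintype.mem_piFinset.mp (Finset.mem_subtype.mp hg)
    -- At the empty monomial the side of the box is `N ^ 0 = 1`, which forces the constant term to
    -- be 1.
    have hf : Function.extend e g.1 0 [] = 1 := by
      have := Finset.mem_Icc.mp (Fintype.mem_piFinset.mp g.2 i₀)
      rw [← hi₀, he.extend_apply]
      rw [hi₀] at this
      simp at this
      omega
    have hrun : ∀ u ∈ B, (runPerm π u g).1 = magnusAct u (Function.extend e g.1 0) ∘ e :=
      fun u hu => hπ u g fun p hp => Fintype.mem_piFinset.mpr fun i =>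
        magnusAct_mem_box he hsub hC hN (hCw p (hpre u hu p hp)) hg i
    refine ⟨?_, fun heq => ?_⟩
    · show toLex (magnusAct w magnusOne ∘ e) < toLex (magnusAct w' magnusOne ∘ e) ↔ _
      rw [toLex_magnusAct_lt_iff hlen hsub hf, ← hrun w hw, ← hrun w' hw']
      rfl
    · have h1 : magnusAct w (Function.extend e g.1 0) ∘ e =
          magnusAct w' (Function.extend e g.1 0) ∘ e := by
        rw [← hrun w hw, ← hrun w' hw', heq]
      have h2 : toLex (magnusAct w magnusOne ∘ e) = toLex (magnusAct w' magnusOne ∘ e) := by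
        refine le_antisymm ?_ ?_ <;> refine not_lt.mp fun h => ?_
        · exact (toLex_magnusAct_lt hlen hsub hf h).ne (congrArg toLex h1).symm
        · exact (toLex_magnusAct_lt hlen hsub hf h).ne (congrArg toLex h1)
      obtain ⟨j, hj⟩ := (hmem (sep w w')).mp (by
        simp only [Finset.mem_insert, Finset.mem_biUnion, List.mem_toFinset, List.mem_sublists]
        exact Or.inr ⟨w, hw, w', hw', List.Sublist.refl _⟩)
      refine hsep w w' hw hw' ?_
      rw [← hj]
      exact congrFun (toLex_inj.mp h2) j

end Magnus

/-! ### Coverings, fibres and balls -/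

namespace FinGraph

variable {G H K : FinGraph}

theorem IsCovering.map_adj {φ : H.V → G.V} (h : IsCovering H G φ) {u v : H.V}
    (huv : H.graph.Adj u v) : G.graph.Adj (φ u) (φ v) := (h.2 u).mapsTo huv

theorem IsCovering.exists_adj {φ : H.V → G.V} (h : IsCovering H G φ) {u : H.V} {v : G.V}
    (huv : G.graph.Adj (φ u) v) : ∃ v', H.graph.Adj u v' ∧ φ v' = v := (h.2 u).surjOn huv

theorem IsCovering.eq_of_adj {φ : H.V → G.V} (h : IsCovering H G φ) {u v w : H.V}
    (hv : H.graph.Adj u v) (hw : H.graph.Adj u w) (hvw : φ v = φ w) : v = w :=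
  (h.2 u).injOn hv hw hvw

theorem IsCovering.id (G : FinGraph) : IsCovering G G id :=
  ⟨Function.surjective_id, fun _ => Set.bijOn_id _⟩

theorem IsCovering.comp {φ : H.V → G.V} {ψ : K.V → H.V} (hφ : IsCovering H G φ)
    (hψ : IsCovering K H ψ) : IsCovering K G (φ ∘ ψ) :=
  ⟨hφ.1.comp hψ.1, fun u => (hφ.2 (ψ u)).comp (hψ.2 u)⟩

theorem IsCovering.deg_eq {φ : H.V → G.V} (h : IsCovering H G φ) (u : H.V) :
    H.deg u = G.deg (φ u) := by
  rw [deg, deg, ← (h.2 u).image_eq, (h.2 u).injOn.ncard_image]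

/-- All fibres of the map have `N` elements. -/
def HasFibres {α β : Type} (φ : α → β) (N : ℕ) : Prop := ∀ v : β, {u | φ u = v}.ncard = N

theorem HasFibres.id (α : Type) : HasFibres (id : α → α) 1 := fun v => by
  simp [Set.ncard_singleton]

theorem HasFibres.sum_comp {α β : Type} [Fintype α] [Fintype β] {φ : α → β} {N : ℕ}
    (h : HasFibres φ N) (f : β → ℕ) : ∑ u, f (φ u) = N * ∑ v, f v := by
  classical
  rw [← Finset.sum_fiberwise (s := Finset.univ) (g := φ), Finset.mul_sum]
  refine Finset.sum_congr rfl fun v _ => ?_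
  rw [Finset.sum_congr rfl (g := fun _ => f v) fun u hu => by rw [(Finset.mem_filter.mp hu).2],
    Finset.sum_const, smul_eq_mul, ← h v, Set.ncard_eq_toFinset_card']
  congr 2
  ext u
  simp

theorem HasFibres.card_eq {α β : Type} [Finite α] [Finite β] {φ : α → β} {N : ℕ}
    (h : HasFibres φ N) : Nat.card α = N * Nat.card β := by
  have := Fintype.ofFinite α
  have := Fintype.ofFinite β
  simpa [Nat.card_eq_fintype_card] using h.sum_comp fun _ => 1

theorem HasFibres.comp {α β γ : Type} [Finite α] [Finite β] [Finite γ] {φ : β → γ} {ψ : α → β}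
    {N M : ℕ} (hφ : HasFibres φ N) (hψ : HasFibres ψ M) : HasFibres (φ ∘ ψ) (M * N) := by
  classical
  have := Fintype.ofFinite α
  have := Fintype.ofFinite β
  intro v
  have h := hψ.sum_comp fun x => if φ x = v then 1 else 0
  simp only [Finset.sum_boole] at h
  rw [← hφ v, Set.ncard_eq_toFinset_card', Set.ncard_eq_toFinset_card']
  simpa using h

/-- Lifting an edge from `v` to `w` at every node above `v` gives a map between the fibres. It is
injective since a node above `w` has only one neighbour above `v`; by symmetry and connectedness all
fibres have the same size. -/
theorem IsCovering.hasFibres {φ : H.V → G.V} (h : IsCovering H G φ)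
    (hG : G.graph.Connected) : ∃ N, HasFibres φ N := by
  obtain ⟨v₀⟩ := hG.nonempty
  have hle : ∀ {v w : G.V}, G.graph.Adj v w →
      {u | φ u = v}.ncard ≤ {u | φ u = w}.ncard := by
    intro v w hvw
    have hex : ∀ u : H.V, ∃ u', φ u = v → H.graph.Adj u u' ∧ φ u' = w := by
      intro u
      by_cases hu : φ u = v
      · subst hu
        obtain ⟨u', hu'⟩ := h.exists_adj hvw
        exact ⟨u', fun _ => hu'⟩
      · exact ⟨u, fun h => absurd h hu⟩
    choose f hf using hex
    refine Set.ncard_le_ncard_of_injOn f (fun u hu => (hf u hu).2) ?_ (Set.toFinite _)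
    intro u hu u' hu' heq
    have h1 := (hf u hu).1
    have h2 := (hf u' hu').1
    rw [← heq] at h2
    exact h.eq_of_adj h1.symm h2.symm (hu.trans hu'.symm)
  refine ⟨{u | φ u = v₀}.ncard, fun v => ?_⟩
  obtain ⟨p⟩ := hG.preconnected v v₀
  induction p with
  | nil => rfl
  | cons hadj _ ih => exact (le_antisymm (hle hadj) (hle hadj.symm)).trans ih

theorem mem_ball_self (u : G.V) (r : ℕ) : u ∈ G.ball u r := by simp [ball]

theorem mem_ball_comm {u v : G.V} {r : ℕ} : v ∈ G.ball u r ↔ u ∈ G.ball v r := by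
  rw [ball, ball, Set.mem_ofPred_eq, Set.mem_ofPred_eq, SimpleGraph.edist_comm]

theorem mem_ball_iff {u v : G.V} {r : ℕ} :
    v ∈ G.ball u r ↔ ∃ p : G.graph.Walk u v, p.length ≤ r := by
  constructor
  · intro h
    have h : G.graph.edist u v ≤ (r : ℕ∞) := h
    have hne : G.graph.edist u v ≠ ⊤ := fun h' => by simp [h'] at h
    obtain ⟨p, hp⟩ := SimpleGraph.exists_walk_of_edist_ne_top hne
    exact ⟨p, by rw [← hp] at h; exact_mod_cast h⟩
  · rintro ⟨p, hp⟩
    exact (SimpleGraph.edist_le p).trans (by exact_mod_cast hp)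

theorem ncard_ball_le {Δ : ℕ} (hG : ∀ u : G.V, G.deg u ≤ Δ) (r : ℕ) (u : G.V) :
    (G.ball u r).ncard ≤ (Δ + 1) ^ r := by
  induction r generalizing u with
  | zero =>
    have : G.ball u 0 = {u} := by
      ext v
      rw [mem_ball_iff, Set.mem_singleton_iff]
      constructor
      · rintro ⟨p, hp⟩
        exact (SimpleGraph.Walk.eq_of_length_eq_zero (Nat.le_zero.mp hp)).symm
      · rintro rfl
        exact ⟨.nil, le_rfl⟩
    rw [this, Set.ncard_singleton, pow_zero]
  | succ r ih =>
    classical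
    have := Fintype.ofFinite G.V
    have hsub : G.ball u (r + 1) ⊆
        ⋃ v ∈ (insert u (G.nbrs u)).toFinset, G.ball v r := by
      intro w hw
      obtain ⟨p, hp⟩ := mem_ball_iff.mp hw
      rw [Set.mem_iUnion₂]
      cases p with
      | nil => exact ⟨u, by simp, mem_ball_self _ _⟩
      | @cons _ v _ h q =>
        refine ⟨v, Set.mem_toFinset.mpr (Or.inr h), mem_ball_iff.mpr ⟨q, ?_⟩⟩
        rw [SimpleGraph.Walk.length_cons] at hp
        omega
    calc (G.ball u (r + 1)).ncard
        ≤ (⋃ v ∈ (insert u (G.nbrs u)).toFinset, G.ball v r).ncard :=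
          Set.ncard_le_ncard hsub (Set.toFinite _)
      _ ≤ ∑ v ∈ (insert u (G.nbrs u)).toFinset, (G.ball v r).ncard :=
          Finset.set_ncard_biUnion_le _ _
      _ ≤ ∑ v ∈ (insert u (G.nbrs u)).toFinset, (Δ + 1) ^ r := Finset.sum_le_sum fun v _ => ih v
      _ = (insert u (G.nbrs u)).ncard * (Δ + 1) ^ r := by
          rw [Finset.sum_const, smul_eq_mul, ← Set.ncard_eq_toFinset_card']
      _ ≤ (Δ + 1) * (Δ + 1) ^ r := by
          refine Nat.mul_le_mul_right _ ((Set.ncard_insert_le _ _).trans ?_)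
          exact Nat.succ_le_succ (hG u)
      _ = _ := by ring

end FinGraph

/-! ### Walks, words and views under coverings -/

open FinGraph

/-- The port through which the letter leaves a node. -/
def Letter.ownPort (a : Letter) : ℕ := if a.2 then a.1.1 else a.1.2

namespace PortsAndOrientation

variable {G H : FinGraph} (P : PortsAndOrientation G)

theorem step_true {u v : G.V} {l : ℕ × ℕ} :
    P.Step u (l, true) v ↔ P.Arc u v ∧ P.label u v = l := Iff.rfl

theorem step_false {u v : G.V} {l : ℕ × ℕ} :
    P.Step u (l, false) v ↔ P.Arc v u ∧ P.label v u = l := Iff.rfl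

variable {P}

theorem Step.adj {u v : G.V} {a : Letter} (h : P.Step u a v) : G.graph.Adj u v := by
  obtain ⟨l, b⟩ := a
  cases b
  · exact (P.adj_of_arc _ _ h.1).symm
  · exact P.adj_of_arc _ _ h.1

theorem Step.port_eq {u v : G.V} {a : Letter} (h : P.Step u a v) :
    P.port u v = Letter.ownPort a := by
  obtain ⟨l, b⟩ := a
  cases b
  · exact congrArg Prod.snd h.2
  · exact congrArg Prod.fst h.2

theorem Step.symm {u v : G.V} {l : ℕ × ℕ} {b : Bool} (h : P.Step u (l, b) v) :
    P.Step v (l, !b) u := by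
  cases b <;> exact h

theorem Step.eq_right {u v v' : G.V} {a : Letter} (h : P.Step u a v) (h' : P.Step u a v') :
    v = v' :=
  (P.port_bijOn u).injOn h.adj h'.adj (h.port_eq.trans h'.port_eq.symm)

theorem exists_step {u v : G.V} (h : G.graph.Adj u v) : ∃ a, P.Step u a v := by
  rcases P.orient u v h with h' | h'
  · exact ⟨(_, true), h'.1, rfl⟩
  · exact ⟨(_, false), h'.1, rfl⟩

theorem Step.eq_letter {u v : G.V} {a a' : Letter} (h : P.Step u a v) (h' : P.Step u a' v) :
    a = a' := by
  have hx := P.orient u v h.adj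
  have : ¬ (P.Arc u v ∧ P.Arc v u) := by
    rintro ⟨h1, h2⟩
    rcases hx with hx | hx
    · exact hx.2 h2
    · exact hx.2 h1
  obtain ⟨l, b⟩ := a
  obtain ⟨l', b'⟩ := a'
  cases b <;> cases b'
  · exact Prod.ext (h.2.symm.trans h'.2) rfl
  · exact absurd ⟨h'.1, h.1⟩ this
  · exact absurd ⟨h.1, h'.1⟩ this
  · exact Prod.ext (h.2.symm.trans h'.2) rfl

theorem port_lt_deg {u v : G.V} (h : G.graph.Adj u v) : P.port u v < G.deg u :=
  (P.port_bijOn u).mapsTo h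

theorem Step.label_lt {Δ : ℕ} (hG : ∀ u : G.V, G.deg u ≤ Δ) {u v : G.V} {a : Letter}
    (h : P.Step u a v) : a.1.1 < Δ ∧ a.1.2 < Δ := by
  have h1 := (P.port_lt_deg h.adj).trans_le (hG u)
  have h2 := (P.port_lt_deg h.adj.symm).trans_le (hG v)
  obtain ⟨l, b⟩ := a
  cases b
  · obtain ⟨-, rfl⟩ := h
    exact ⟨h2, h1⟩
  · obtain ⟨-, rfl⟩ := h
    exact ⟨h1, h2⟩

theorem isWalk_append {w w' : List Letter} {u v : G.V} :
    P.IsWalk u (w ++ w') v ↔ ∃ x, P.IsWalk u w x ∧ P.IsWalk x w' v := by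
  induction w generalizing u with
  | nil => simp [IsWalk]
  | cons a w ih =>
    simp only [List.cons_append, IsWalk, ih]
    constructor
    · rintro ⟨u', h1, x, h2, h3⟩
      exact ⟨x, ⟨u', h1, h2⟩, h3⟩
    · rintro ⟨x, ⟨u', h1, h2⟩, h3⟩
      exact ⟨u', h1, x, h2, h3⟩

theorem isWalk_singleton {a : Letter} {u v : G.V} : P.IsWalk u [a] v ↔ P.Step u a v := by
  simp [IsWalk]

theorem IsWalk.eq_right {w : List Letter} {u v v' : G.V} (h : P.IsWalk u w v)
    (h' : P.IsWalk u w v') : v = v' := by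
  induction w generalizing u with
  | nil => exact h.symm.trans h'
  | cons a w ih =>
    obtain ⟨x, hx, h⟩ := h
    obtain ⟨x', hx', h'⟩ := h'
    obtain rfl := hx.eq_right hx'
    exact ih h h'

theorem IsWalk.red {w w' : List Letter} {u v : G.V} (hw : FreeGroup.Red w w')
    (h : P.IsWalk u w v) : P.IsWalk u w' v := by
  induction hw with
  | refl => exact h
  | tail _ hs ih =>
    cases hs with
    | not =>
      obtain ⟨x, h1, y, h2, z, h3, h4⟩ := isWalk_append.mp ih
      obtain rfl := h2.symm.eq_right h3
      exact isWalk_append.mpr ⟨_, h1, h4⟩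

theorem IsWalk.mem_ball {w : List Letter} {u v : G.V} (h : P.IsWalk u w v) :
    v ∈ G.ball u w.length := by
  rw [mem_ball_iff]
  induction w generalizing u with
  | nil =>
    obtain rfl : u = v := h
    exact ⟨.nil, le_rfl⟩
  | cons a w ih =>
    obtain ⟨x, hx, h⟩ := h
    obtain ⟨p, hp⟩ := ih h
    exact ⟨.cons hx.adj p, Nat.succ_le_succ hp⟩

theorem exists_isWalk {u v : G.V} (p : G.graph.Walk u v) :
    ∃ w, w.length = p.length ∧ P.IsWalk u w v := by
  induction p with
  | nil => exact ⟨[], rfl, rfl⟩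
  | cons h p ih =>
    obtain ⟨w, hw, h'⟩ := ih
    obtain ⟨a, ha⟩ := P.exists_step h
    exact ⟨a :: w, by simp [hw], _, ha, h'⟩

/-- The nodes of the view truncated to radius `r`: the reduced words of length at most `r` that
spell a walk starting at `u`. -/
def words (P : PortsAndOrientation G) (r : ℕ) (u : G.V) : Set (List Letter) :=
  {w | FreeGroup.IsReduced w ∧ w.length ≤ r ∧ ∃ v, P.IsWalk u w v}

/-- Cancelling backtracking steps shortens a walk and keeps its ends. -/
theorem mem_ball_iff_exists_reduced {u v : G.V} {r : ℕ} :
    v ∈ G.ball u r ↔ ∃ w ∈ P.words r u, P.IsWalk u w v := by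
  constructor
  · intro h
    obtain ⟨p, hp⟩ := mem_ball_iff.mp h
    obtain ⟨w, hw, hwalk⟩ := P.exists_isWalk p
    have hred := FreeGroup.reduce.red (L := w)
    refine ⟨FreeGroup.reduce w, ⟨.of_reduce_eq FreeGroup.reduce.idem, ?_, v, hwalk.red hred⟩,
      hwalk.red hred⟩
    exact hred.length_le.trans (hw.trans_le hp)
  · rintro ⟨w, ⟨-, hl, -⟩, hw⟩
    have h1 : G.graph.edist u v ≤ (w.length : ℕ∞) := hw.mem_ball
    exact h1.trans (by exact_mod_cast hl)

theorem view_congr {I : Type} {x x' : G.V → I} {r : ℕ} {u : G.V}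
    (h : ∀ v ∈ G.ball u r, x v = x' v) : P.view x r u = P.view x' r u := by
  have aux : ∀ {x x' : G.V → I}, (∀ v ∈ G.ball u r, x v = x' v) →
      P.view x r u ⊆ P.view x' r u := by
    rintro x x' h ⟨w, i⟩ ⟨hr, hl, v, hw, hi⟩
    exact ⟨hr, hl, v, hw, hi.trans (h v (mem_ball_iff_exists_reduced.mpr
      ⟨w, ⟨hr, hl, v, hw⟩, hw⟩))⟩
  exact (aux h).antisymm (aux fun v hv => (h v hv).symm)

theorem fst_image_view {I : Type} (x : G.V → I) (r : ℕ) (u : G.V) :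
    Prod.fst '' P.view x r u = P.words r u := by
  ext w
  constructor
  · rintro ⟨⟨w, i⟩, ⟨hr, hl, v, hw, -⟩, rfl⟩
    exact ⟨hr, hl, v, hw⟩
  · rintro ⟨hr, hl, v, hw⟩
    exact ⟨(w, x v), ⟨hr, hl, v, hw, rfl⟩, rfl⟩

/-- The port numbering and orientation of a lift. -/
def pullback (P : PortsAndOrientation G) {φ : H.V → G.V} (h : IsCovering H G φ) :
    PortsAndOrientation H where
  port u v := P.port (φ u) (φ v)
  port_bijOn u := by
    rw [h.deg_eq u]
    exact (P.port_bijOn (φ u)).comp (h.2 u)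
  Arc u v := H.graph.Adj u v ∧ P.Arc (φ u) (φ v)
  adj_of_arc u v huv := huv.1
  orient u v huv := by
    rcases P.orient _ _ (h.map_adj huv) with h' | h'
    · exact Or.inl ⟨⟨huv, h'.1⟩, fun h => h'.2 h.2⟩
    · exact Or.inr ⟨⟨huv.symm, h'.1⟩, fun h => h'.2 h.2⟩

variable {φ : H.V → G.V} {h : IsCovering H G φ}

theorem pullback_step {u v : H.V} {a : Letter} :
    (P.pullback h).Step u a v ↔ H.graph.Adj u v ∧ P.Step (φ u) a (φ v) := by
  obtain ⟨l, b⟩ := a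
  cases b
  · simp only [step_false, pullback, label, H.graph.adj_comm u v, and_assoc]
  · simp only [step_true, pullback, label, and_assoc]

theorem IsWalk.map {w : List Letter} {u v : H.V} (hw : (P.pullback h).IsWalk u w v) :
    P.IsWalk (φ u) w (φ v) := by
  induction w generalizing u with
  | nil => exact congrArg φ hw
  | cons a w ih =>
    obtain ⟨x, hx, hw⟩ := hw
    exact ⟨φ x, (pullback_step.mp hx).2, ih hw⟩

theorem IsWalk.exists_lift {w : List Letter} {u : H.V} {v : G.V} (hw : P.IsWalk (φ u) w v) :
    ∃ v', φ v' = v ∧ (P.pullback h).IsWalk u w v' := by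
  induction w generalizing u with
  | nil => exact ⟨u, hw, rfl⟩
  | cons a w ih =>
    obtain ⟨x, hx, hw⟩ := hw
    obtain ⟨x', hx', rfl⟩ := h.exists_adj hx.adj
    obtain ⟨v', hv', hw'⟩ := ih hw
    exact ⟨v', hv', x', pullback_step.mpr ⟨hx', hx⟩, hw'⟩

/-- Walks lift uniquely along coverings, so a `PO`-algorithm cannot tell a lift from its base,
provided that the inputs are lifted as well. -/
theorem pullback_view {I : Type} (x : G.V → I) (r : ℕ) (u : H.V) :
    (P.pullback h).view (x ∘ φ) r u = P.view x r (φ u) := by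
  ext ⟨w, i⟩
  constructor
  · rintro ⟨hr, hl, v, hw, hi⟩
    exact ⟨hr, hl, φ v, hw.map, hi⟩
  · rintro ⟨hr, hl, v, hw, hi⟩
    obtain ⟨v', rfl, hw'⟩ := hw.exists_lift (h := h)
    exact ⟨hr, hl, v', hw', hi⟩

end PortsAndOrientation

/-! ### Tree-like neighbourhoods as graphs on words -/

open FinGraph PortsAndOrientation

/-- The labels `x` and `y` of a node `u` describe the same solution at `u`, with respect to the
port numberings `p` and `q`. -/
def LabelsMatch (Δ : ℕ) (G : FinGraph) (p q : G.V → G.V → ℕ) :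
    (k : SolutionKind) → k.Label Δ → k.Label Δ → G.V → Prop
  | .nodes, x, y, _ => x = y
  | .edges, x, y, u => ∀ v, G.graph.Adj u v → ∀ i j : Fin Δ, (i : ℕ) = p u v → (j : ℕ) = q u v →
      x i = y j

/-- The tree of the words in `W`, where the word `w` gets the identifier `f w`. -/
def wordGraph (W : Set (List Letter)) (f : List Letter → ℕ) : PointedIDGraph where
  verts := f '' W
  Adj a b := ∃ w ∈ W, ∃ w' ∈ W, f w = a ∧ f w' = b ∧ ∃ c, w' = w ++ [c] ∨ w = w' ++ [c]
  root := f []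

theorem wordGraph_congr {W : Set (List Letter)} {f f' : List Letter → ℕ} (h0 : [] ∈ W)
    (h : ∀ w ∈ W, f w = f' w) : wordGraph W f = wordGraph W f' := by
  simp only [wordGraph, PointedIDGraph.mk.injEq]
  refine ⟨Set.image_congr h, ?_, h _ h0⟩
  funext a b
  refine propext ⟨?_, ?_⟩
  · rintro ⟨w, hw, w', hw', rfl, rfl, hc⟩
    exact ⟨w, hw, w', hw', (h w hw).symm, (h w' hw').symm, hc⟩
  · rintro ⟨w, hw, w', hw', rfl, rfl, hc⟩
    exact ⟨w, hw, w', hw', h w hw, h w' hw', hc⟩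

theorem FreeGroup.IsReduced.exists_of_not_isReduced_concat {α : Type*} {w : List (α × Bool)}
    {a : α × Bool} (hw : FreeGroup.IsReduced w) (h : ¬ FreeGroup.IsReduced (w ++ [a])) :
    ∃ w₀, w = w₀ ++ [(a.1, !a.2)] := by
  rcases List.eq_nil_or_concat w with rfl | ⟨w₀, b, rfl⟩
  · exact absurd FreeGroup.IsReduced.singleton h
  · rw [List.concat_eq_append] at hw h ⊢
    refine ⟨w₀, ?_⟩
    have h2 : ¬ FreeGroup.IsReduced [b, a] := fun h2 => by
      apply h
      have := FreeGroup.IsReduced.append_overlap (L₁ := w₀) (L₂ := [b]) (L₃ := [a]) hw h2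
        (List.cons_ne_nil _ _)
      exact this
    simp only [FreeGroup.IsReduced, List.isChain_cons_cons, List.isChain_singleton, and_true,
      Classical.not_imp] at h2
    obtain ⟨b1, b2⟩ := b
    obtain ⟨a1, a2⟩ := a
    simp only at h2
    rw [h2.1, Bool.eq_not_of_ne h2.2]

/-- Where the ball is a tree, the neighbourhood is determined by the words that spell the walks
and the identifiers of their end nodes. -/
theorem Identifiers.neighbourhood_eq_wordGraph {s : ℕ → ℕ} {G : FinGraph}
    (ι : Identifiers s G) (P : PortsAndOrientation G) {r : ℕ} {x : G.V}
    (hinj : ∀ w ∈ P.words (r + 1) x, ∀ w' ∈ P.words (r + 1) x, ∀ v, P.IsWalk x w v →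
      P.IsWalk x w' v → w = w') {f : List Letter → ℕ}
    (hf : ∀ w ∈ P.words r x, ∀ v, P.IsWalk x w v → f w = ι.id v) :
    ι.neighbourhood r x = wordGraph (P.words r x) f := by
  have hsucc : ∀ w ∈ P.words r x, w ∈ P.words (r + 1) x := fun w hw =>
    ⟨hw.1, hw.2.1.trans (Nat.le_succ r), hw.2.2⟩
  have h0 : [] ∈ P.words r x := ⟨FreeGroup.IsReduced.nil, Nat.zero_le _, x, rfl⟩
  simp only [neighbourhood, wordGraph, PointedIDGraph.mk.injEq]
  refine ⟨?_, ?_, ?_⟩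
  · ext n
    constructor
    · rintro ⟨v, hv, rfl⟩
      obtain ⟨w, hw, hwv⟩ := P.mem_ball_iff_exists_reduced.mp hv
      exact ⟨w, hw, hf w hw v hwv⟩
    · rintro ⟨w, hw, rfl⟩
      obtain ⟨v, hwv⟩ := hw.2.2
      exact ⟨v, P.mem_ball_iff_exists_reduced.mpr ⟨w, hw, hwv⟩, (hf w hw v hwv).symm⟩
  · funext a b
    refine propext ⟨?_, ?_⟩
    · rintro ⟨v, hv, v', hv', rfl, rfl, hadj⟩
      obtain ⟨w, hw, hwv⟩ := P.mem_ball_iff_exists_reduced.mp hv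
      obtain ⟨w', hw', hwv'⟩ := P.mem_ball_iff_exists_reduced.mp hv'
      refine ⟨w, hw, w', hw', hf w hw v hwv, hf w' hw' v' hwv', ?_⟩
      obtain ⟨c, hc⟩ := P.exists_step hadj
      -- An edge between two nodes at distance `r` would be reached by a word of length `r + 1`;
      -- this is why injectivity is required one step further out. If the word `w ++ [c]` is not
      -- reduced, then `c` undoes the last letter of `w`.
      by_cases hred : FreeGroup.IsReduced (w ++ [c])
      · have hwalk : P.IsWalk x (w ++ [c]) v' :=
          isWalk_append.mpr ⟨v, hwv, isWalk_singleton.mpr hc⟩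
        refine ⟨c, Or.inl (hinj w' (hsucc _ hw') (w ++ [c]) ⟨hred, ?_, v', hwalk⟩ v' hwv' hwalk)⟩
        rw [List.length_append]
        exact Nat.succ_le_succ hw.2.1
      · obtain ⟨w₀, rfl⟩ := hw.1.exists_of_not_isReduced_concat hred
        obtain ⟨y, hy, hyv⟩ := isWalk_append.mp hwv
        obtain rfl := (isWalk_singleton.mp hyv).symm.eq_right (by simpa using hc)
        refine ⟨(c.1, !c.2), Or.inr ?_⟩
        rw [hinj w' (hsucc _ hw') w₀ ⟨hw.1.infix ⟨[], _, rfl⟩, ?_, y, hy⟩ y hwv' hy]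
        have := hw.2.1
        rw [List.length_append] at this
        omega
    · rintro ⟨w, hw, w', hw', rfl, rfl, c, hc⟩
      obtain ⟨v, hwv⟩ := hw.2.2
      obtain ⟨v', hwv'⟩ := hw'.2.2
      refine ⟨v, P.mem_ball_iff_exists_reduced.mpr ⟨w, hw, hwv⟩, v',
        P.mem_ball_iff_exists_reduced.mpr ⟨w', hw', hwv'⟩, (hf w hw v hwv).symm,
        (hf w' hw' v' hwv').symm, ?_⟩
      rcases hc with rfl | rfl
      · obtain ⟨y, hy, hyv⟩ := isWalk_append.mp hwv'
        obtain rfl := hy.eq_right hwv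
        exact (isWalk_singleton.mp hyv).adj
      · obtain ⟨y, hy, hyv⟩ := isWalk_append.mp hwv
        obtain rfl := hy.eq_right hwv'
        exact (isWalk_singleton.mp hyv).adj.symm
  · exact (hf [] h0 x rfl).symm

theorem finite_boundedWords (Δ R : ℕ) : {w : List Letter | FreeGroup.IsReduced w ∧
    w.length ≤ R ∧ ∀ a ∈ w, a.1.1 < Δ ∧ a.1.2 < Δ}.Finite := by
  have hfin : {a : Letter | a.1.1 < Δ ∧ a.1.2 < Δ}.Finite := by
    refine (((Set.finite_Iio Δ).prod (Set.finite_Iio Δ)).prod (Set.finite_univ (α := Bool))).subset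
      fun a ha => ?_
    exact ⟨⟨ha.1, ha.2⟩, Set.mem_univ _⟩
  have := hfin.to_subtype
  refine ((List.finite_length_le {a : Letter | a.1.1 < Δ ∧ a.1.2 < Δ} R).image
    (List.map Subtype.val)).subset fun w hw => ?_
  lift w to List {a : Letter // a.1.1 < Δ ∧ a.1.2 < Δ} using hw.2.2
  refine ⟨w, ?_, rfl⟩
  have := hw.2.1
  rwa [List.length_map] at this

/-- The reduced words of length at most `R` with port numbers less than `Δ`. -/
noncomputable def boundedWords (Δ R : ℕ) : Finset (List Letter) := (finite_boundedWords Δ R).toFinset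

theorem mem_boundedWords {Δ R : ℕ} {w : List Letter} : w ∈ boundedWords Δ R ↔
    FreeGroup.IsReduced w ∧ w.length ≤ R ∧ ∀ a ∈ w, a.1.1 < Δ ∧ a.1.2 < Δ := by
  simp [boundedWords]

theorem PortsAndOrientation.IsWalk.label_lt {Δ : ℕ} {G : FinGraph} {P : PortsAndOrientation G}
    (hG : ∀ u : G.V, G.deg u ≤ Δ) {w : List Letter} {u v : G.V} (h : P.IsWalk u w v) :
    ∀ a ∈ w, a.1.1 < Δ ∧ a.1.2 < Δ := by
  induction w generalizing u with
  | nil => simp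
  | cons b w ih =>
    obtain ⟨x, hx, h⟩ := h
    intro a ha
    rcases List.mem_cons.mp ha with rfl | ha
    · exact hx.label_lt hG
    · exact ih h a ha

theorem PortsAndOrientation.words_subset_boundedWords {Δ : ℕ} {G : FinGraph}
    (P : PortsAndOrientation G) (hG : ∀ u : G.V, G.deg u ≤ Δ) (R : ℕ) (u : G.V) :
    P.words R u ⊆ boundedWords Δ R := fun _ hw =>
  mem_boundedWords.mpr ⟨hw.1, hw.2.1, hw.2.2.choose_spec.label_lt hG⟩

/-! ### Simulating an `ID`-algorithm on homogeneously ordered trees -/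

section Simulation

variable (lt : List Letter → List Letter → Prop)

open Classical in
/-- The position of `w` in the ordered set `W`. -/
noncomputable def wordRank (W : Finset (List Letter)) (w : List Letter) : ℕ :=
  (W.filter fun w' => lt w' w).card

/-- The output of an `ID`-algorithm on the tree of the words in `W`, with the identifiers in `U`
assigned in increasing order. -/
noncomputable def outputOn {O : Type} (A : IDAlgorithm O) (W : Finset (List Letter))
    (U : Finset ℕ) : O :=
  A.output (wordGraph W fun w => Nat.nth (· ∈ U) (wordRank lt W w))

/-- As `f` transports `lt` to the order of the numbers, the rank of `w` counts the elements of the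
image below `f w`. -/
theorem nth_wordRank {W : Finset (List Letter)} {f : List Letter → ℕ}
    (hlt : ∀ w ∈ W, ∀ w' ∈ W, (lt w w' ↔ f w < f w')) (hf : Set.InjOn f W) {w : List Letter}
    (hw : w ∈ W) : Nat.nth (· ∈ W.image f) (wordRank lt W w) = f w := by
  classical
  have : wordRank lt W w = Nat.count (· ∈ W.image f) (f w) := by
    rw [Nat.count_eq_card_filter_range, wordRank]
    refine Finset.card_bij (fun w' _ => f w') ?_ ?_ ?_
    · intro w' hw'
      rw [Finset.mem_filter] at hw' ⊢
      exact ⟨Finset.mem_range.mpr ((hlt w' hw'.1 w hw).mp hw'.2), Finset.mem_image_of_mem f hw'.1⟩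
    · intro w₁ h₁ w₂ h₂ h
      exact hf (Finset.mem_filter.mp h₁).1 (Finset.mem_filter.mp h₂).1 h
    · intro n hn
      rw [Finset.mem_filter, Finset.mem_range] at hn
      obtain ⟨w', hw', rfl⟩ := Finset.mem_image.mp hn.2
      exact ⟨w', Finset.mem_filter.mpr ⟨hw', (hlt w' hw' w hw).mpr hn.1⟩, rfl⟩
  rw [this]
  exact Nat.nth_count (Finset.mem_image_of_mem f hw)

variable {Δ : ℕ} {k : SolutionKind} (A : IDAlgorithm (k.Label Δ))

/-- On the set `T` of identifiers the outputs of the algorithm on trees depend only on the order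
of the identifiers, and are given by `c`. -/
def IsMonochromatic (T : Finset ℕ)
    (c : (boundedWords Δ A.radius).powerset → k.Label Δ) : Prop :=
  ∀ (W : (boundedWords Δ A.radius).powerset) (U : Finset ℕ), U ⊆ T → U.card = W.1.card →
    outputOn lt A W.1 U = c W

open Classical in
/-- Translate an output that refers to the ordering `lt` of the neighbours into an output that
refers to the ports. -/
noncomputable def translatePorts (W : Set (List Letter)) :
    (k : SolutionKind) → k.Label Δ → k.Label Δ
  | .nodes, o => o
  | .edges, o => fun i => decide (∃ a : Letter, [a] ∈ W ∧ Letter.ownPort a = i ∧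
      ∃ j : Fin Δ, (j : ℕ) = {b : Letter | [b] ∈ W ∧ lt [b] [a]}.ncard ∧ o j = true)

open Classical in
/-- The `PO`-algorithm that simulates an `ID`-algorithm with outputs given by `c`, on trees whose
identifiers are ordered according to `lt`. -/
noncomputable def simulation [Inhabited (k.Label Δ)]
    (c : (boundedWords Δ A.radius).powerset → k.Label Δ) :
    POAlgorithm Unit (k.Label Δ) where
  -- One step more than the simulated radius, so that the incident letters are visible for the
  -- translation of ports even if `A.radius = 0`.
  radius := A.radius + 1
  output V := translatePorts lt (Prod.fst '' V) k
    -- When all degrees are at most `Δ` the words of length at most `A.radius` form a subset of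
    -- `boundedWords`, and the default is not used.
    (if h : ∃ W : (boundedWords Δ A.radius).powerset,
      (W.1 : Set (List Letter)) = {w ∈ Prod.fst '' V | w.length ≤ A.radius} then c h.choose
      else default)

/-- The neighbourhood of `x` is the tree of its words, with identifiers from `T` that are ordered by
`lt`. Hence the output is the colour that `c` assigns to this set of words, which the view reveals.
-/
theorem labelsMatch_simulation [Inhabited (k.Label Δ)]
    {c : (boundedWords Δ A.radius).powerset → k.Label Δ} {T : Finset ℕ}
    (hT : IsMonochromatic lt A T c) {s : ℕ → ℕ} {G : FinGraph} (hG : ∀ u : G.V, G.deg u ≤ Δ)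
    (ι : Identifiers s G) (P : PortsAndOrientation G) {x : G.V}
    (hlt : ∀ w ∈ P.words (A.radius + 1) x, ∀ w' ∈ P.words (A.radius + 1) x, ∀ v v',
      P.IsWalk x w v → P.IsWalk x w' v' → (lt w w' ↔ ι.id v < ι.id v'))
    (hinj : ∀ w ∈ P.words (A.radius + 1) x, ∀ w' ∈ P.words (A.radius + 1) x, ∀ v,
      P.IsWalk x w v → P.IsWalk x w' v → w = w')
    (hid : ∀ v ∈ G.ball x A.radius, ι.id v ∈ T) :
    LabelsMatch Δ G ι.port P.port k (A.run ι x)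
      ((simulation lt A c).run P (fun _ => ()) x) x := by
  classical
  have hsucc : ∀ w ∈ P.words A.radius x, w ∈ P.words (A.radius + 1) x := fun w hw =>
    ⟨hw.1, hw.2.1.trans (Nat.le_succ _), hw.2.2⟩
  have hWfin : (P.words A.radius x).Finite :=
    (boundedWords Δ A.radius).finite_toSet.subset (P.words_subset_boundedWords hG A.radius x)
  set W : Finset (List Letter) := hWfin.toFinset with hW
  have hWcoe : (W : Set (List Letter)) = P.words A.radius x := hWfin.coe_toFinset
  have hmemW : ∀ {w}, w ∈ W ↔ w ∈ P.words A.radius x := by simp [hW]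
  have hWp : W ∈ (boundedWords Δ A.radius).powerset := Finset.mem_powerset.mpr fun w hw =>
    P.words_subset_boundedWords hG A.radius x (hmemW.mp hw)
  obtain ⟨f, hf⟩ : ∃ f : List Letter → ℕ, ∀ w v, P.IsWalk x w v → f w = ι.id v := by
    refine ⟨fun w => if h : ∃ v, P.IsWalk x w v then ι.id h.choose else 0, fun w v hwv => ?_⟩
    have h : ∃ v, P.IsWalk x w v := ⟨v, hwv⟩
    simp only [h, dif_pos]
    rw [h.choose_spec.eq_right hwv]
  have hout : A.run ι x = c ⟨W, hWp⟩ := by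
    have hfinj : Set.InjOn f W := by
      intro w hw w' hw' heq
      rw [hWcoe] at hw hw'
      obtain ⟨v, hv⟩ := hw.2.2
      obtain ⟨v', hv'⟩ := hw'.2.2
      rw [hf w v hv, hf w' v' hv'] at heq
      obtain rfl := ι.injective heq
      exact hinj w (hsucc w hw) w' (hsucc w' hw') v hv hv'
    rw [← hT ⟨W, hWp⟩ (W.image f) ?_ (Finset.card_image_of_injOn hfinj), IDAlgorithm.run,
      ι.neighbourhood_eq_wordGraph P hinj (fun w _ v hv => hf w v hv), outputOn, hWcoe]
    · refine congrArg A.output (wordGraph_congr ⟨FreeGroup.IsReduced.nil, Nat.zero_le _, x, rfl⟩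
        fun w hw => (nth_wordRank lt ?_ hfinj (hmemW.mpr hw)).symm)
      intro w hw w' hw'
      obtain ⟨v, hv⟩ := (hmemW.mp hw).2.2
      obtain ⟨v', hv'⟩ := (hmemW.mp hw').2.2
      rw [hf w v hv, hf w' v' hv']
      exact hlt w (hsucc w (hmemW.mp hw)) w' (hsucc w' (hmemW.mp hw')) v v' hv hv'
    · intro n hn
      obtain ⟨w, hw, rfl⟩ := Finset.mem_image.mp hn
      obtain ⟨v, hv⟩ := (hmemW.mp hw).2.2
      rw [hf w v hv]
      exact hid v (P.mem_ball_iff_exists_reduced.mpr ⟨w, hmemW.mp hw, hv⟩)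
  have hrun : (simulation lt A c).run P (fun _ => ()) x =
      translatePorts lt (P.words (A.radius + 1) x) k (A.run ι x) := by
    have hview : Prod.fst '' P.view (fun _ => ()) (A.radius + 1) x = P.words (A.radius + 1) x :=
      fst_image_view _ _ _
    have hset : {w ∈ P.words (A.radius + 1) x | w.length ≤ A.radius} = P.words A.radius x := by
      ext w
      constructor
      · rintro ⟨⟨h1, -, h2⟩, h3⟩
        exact ⟨h1, h3, h2⟩
      · rintro ⟨h1, h3, h2⟩
        exact ⟨⟨h1, h3.trans (Nat.le_succ _), h2⟩, h3⟩
    simp only [POAlgorithm.run, simulation, hview, hset]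
    have h : ∃ W : (boundedWords Δ A.radius).powerset, (W.1 : Set (List Letter)) = P.words A.radius x :=
      ⟨⟨W, hWp⟩, hWcoe⟩
    rw [dif_pos h, hout]
    congr 2
    exact Subtype.ext (Finset.coe_injective (h.choose_spec.trans hWcoe.symm))
  rw [hrun]
  have hword : ∀ {a : Letter} {v : G.V}, P.Step x a v → [a] ∈ P.words (A.radius + 1) x :=
    fun {a v} h => ⟨FreeGroup.IsReduced.singleton, by simp, v, isWalk_singleton.mpr h⟩
  cases k with
  | nodes => rfl
  | edges =>
    intro v hv i j hi hj
    obtain ⟨a, ha⟩ := P.exists_step hv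
    -- Incident edges correspond to words of one letter, so the order of the neighbours by
    -- identifier is the order `lt` on these words.
    have hport : {b : Letter | [b] ∈ P.words (A.radius + 1) x ∧ lt [b] [a]}.ncard = ι.port x v := by
      refine Set.ncard_congr (fun b hb => (hb.1.2.2.choose)) ?_ ?_ ?_
      · intro b hb
        have hs := hb.1.2.2.choose_spec
        exact ⟨(isWalk_singleton.mp hs).adj,
          (hlt _ hb.1 _ (hword ha) _ _ hs (isWalk_singleton.mpr ha)).mp hb.2⟩
      · intro b b' hb hb' heq
        have hs := isWalk_singleton.mp hb.1.2.2.choose_spec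
        have hs' := isWalk_singleton.mp hb'.1.2.2.choose_spec
        rw [← heq] at hs'
        exact hs.eq_letter hs'
      · rintro u ⟨hu, hlt'⟩
        obtain ⟨b, hb⟩ := P.exists_step hu
        have hbm : [b] ∈ P.words (A.radius + 1) x ∧ lt [b] [a] := ⟨hword hb,
          (hlt _ (hword hb) _ (hword ha) _ _ (isWalk_singleton.mpr hb)
            (isWalk_singleton.mpr ha)).mpr hlt'⟩
        exact ⟨b, hbm, hbm.1.2.2.choose_spec.eq_right (isWalk_singleton.mpr hb)⟩
    rw [Bool.eq_iff_iff]
    simp only [translatePorts, decide_eq_true_eq]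
    constructor
    · intro h
      exact ⟨a, hword ha, by rw [hj]; exact ha.port_eq.symm, i, hi.trans hport.symm, h⟩
    · rintro ⟨b, ⟨-, -, u, hb⟩, hbj, i', hi', h⟩
      rw [isWalk_singleton] at hb
      have huv : u = v := (P.port_bijOn x).injOn hb.adj hv (by rw [hb.port_eq, hbj, hj])
      subst huv
      obtain rfl := hb.eq_letter ha
      rw [hport, ← hi] at hi'
      rwa [← Fin.ext hi']

end Simulation

/-! ### Permutation lifts and cyclic lifts -/

namespace PortsAndOrientation

variable {G : FinGraph} (P : PortsAndOrientation G)

theorem arc_irrefl (u : G.V) : ¬ P.Arc u u := fun h => (P.adj_of_arc _ _ h).ne rfl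

theorem not_arc_symm {u v : G.V} (h : P.Arc u v) : ¬ P.Arc v u := fun h' => by
  rcases P.orient u v (P.adj_of_arc _ _ h) with hx | hx
  · exact hx.2 h'
  · exact hx.2 h

/-- The lift of `G` with fibre `X` in which the arc from `u` to `v` is covered by the arcs from
`(u, g)` to `(v, σ u v g)`. -/
def permLift (X : Type) [Finite X] (σ : G.V → G.V → Equiv.Perm X) : FinGraph where
  V := G.V × X
  graph :=
    { Adj := fun x y => (P.Arc x.1 y.1 ∧ y.2 = σ x.1 y.1 x.2) ∨
        (P.Arc y.1 x.1 ∧ x.2 = σ y.1 x.1 y.2)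
      symm := ⟨fun _ _ h => h.symm⟩
      loopless := ⟨fun x h => by
        rcases h with h | h <;> exact P.arc_irrefl _ h.1⟩ }

variable {P} {X : Type} [Finite X] {σ : G.V → G.V → Equiv.Perm X}

variable (P σ)

theorem isCovering_permLift [Nonempty X] :
    IsCovering (P.permLift X σ) G (Prod.fst : G.V × X → G.V) := by
  refine ⟨Prod.fst_surjective, fun ⟨u, g⟩ => ⟨?_, ?_, ?_⟩⟩
  · rintro ⟨v, h⟩ (hv | hv)
    · exact P.adj_of_arc _ _ hv.1
    · exact (P.adj_of_arc _ _ hv.1).symm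
  · rintro ⟨v, h⟩ hv ⟨v', h'⟩ hv' (rfl : v = v')
    rcases hv with hv | hv <;> rcases hv' with hv' | hv'
    · exact Prod.ext rfl (hv.2.trans hv'.2.symm)
    · exact absurd hv'.1 (P.not_arc_symm hv.1)
    · exact absurd hv.1 (P.not_arc_symm hv'.1)
    · exact Prod.ext rfl ((σ v u).injective (hv.2.symm.trans hv'.2))
  · intro v hv
    rcases P.orient u v hv with h | h
    · exact ⟨(v, σ u v g), Or.inl ⟨h.1, rfl⟩, rfl⟩
    · exact ⟨(v, (σ v u).symm g), Or.inr ⟨h.1, by simp⟩, rfl⟩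

omit [Finite X] in
theorem hasFibres_fst : HasFibres (Prod.fst : G.V × X → G.V) (Nat.card X) := by
  intro v
  have : {x : G.V × X | x.1 = v} = (fun g : X => (v, g)) '' Set.univ := by
    ext ⟨u, g⟩
    simp [eq_comm]
  rw [this, Set.InjOn.ncard_image fun a _ b _ h => congrArg Prod.snd h, Set.ncard_univ]

variable {P}

/-- The permutation on an arc depends only on its label, so a walk moves the fibre coordinate in a
way determined by its word alone. -/
theorem isWalk_permLift_label [Nonempty X] (π : ℕ × ℕ → Equiv.Perm X) {w : List Letter}
    {x y : G.V × X}
    (h : (P.pullback (P.isCovering_permLift fun u v => π (P.label u v))).IsWalk x w y) :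
    y.2 = runPerm π w x.2 := by
  induction w generalizing x with
  | nil => exact congrArg Prod.snd (Eq.symm h)
  | cons a w ih =>
    obtain ⟨z, hz, h⟩ := h
    rw [ih h, runPerm]
    congr 1
    obtain ⟨hadj, hstep⟩ := pullback_step.mp hz
    obtain ⟨l, b⟩ := a
    rcases hadj with hadj | hadj <;> cases b
    · exact absurd hstep.1 (P.not_arc_symm hadj.1)
    · obtain rfl : P.label x.1 z.1 = l := hstep.2
      exact hadj.2
    · obtain rfl : P.label z.1 x.1 = l := hstep.2
      exact (Equiv.eq_symm_apply _).mpr hadj.2.symm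
    · exact absurd hstep.1 (P.not_arc_symm hadj.1)

open Classical in
/-- The permutations that define the cyclic lift along an arc. -/
noncomputable def cyclicPerm (a b : G.V) (m : ℕ) (u v : G.V) : Equiv.Perm (Fin (m + 1)) :=
  if u = a ∧ v = b then Equiv.addRight 1 else 1

/-- The cyclic lift along the arc from `a` to `b`. -/
noncomputable def cyclicLift (P : PortsAndOrientation G) (a b : G.V) (m : ℕ) : FinGraph :=
  P.permLift (Fin (m + 1)) (cyclicPerm a b m)

theorem isCovering_cyclicLift (P : PortsAndOrientation G) (a b : G.V) (m : ℕ) :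
    IsCovering (P.cyclicLift a b m) G (Prod.fst : G.V × Fin (m + 1) → G.V) :=
  P.isCovering_permLift _

theorem card_cyclicLift (P : PortsAndOrientation G) (a b : G.V) (m : ℕ) :
    Nat.card (P.cyclicLift a b m).V = Nat.card G.V * (m + 1) :=
  (Nat.card_prod _ _).trans (by rw [Nat.card_fin])

/-- Far from the distinguished arc, walks in the cyclic lift stay on one level. -/
theorem isWalk_cyclicLift {a b : G.V} {m r : ℕ} {w : List Letter}
    {x y : G.V × Fin (m + 1)} (hr : w.length ≤ r) (ha : a ∉ G.ball x.1 r)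
    (h : (P.pullback (P.isCovering_cyclicLift a b m)).IsWalk x w y) : y.2 = x.2 := by
  induction w generalizing x r with
  | nil => exact congrArg Prod.snd (Eq.symm h)
  | cons c w ih =>
    obtain ⟨z, hz, h⟩ := h
    obtain ⟨r, rfl⟩ : ∃ r', r = r' + 1 := ⟨r - 1, by simp at hr; omega⟩
    obtain ⟨hadj, hstep⟩ := pullback_step.mp hz
    have hstep : P.Step x.1 c z.1 := hstep
    have hball : ∀ v, v ∈ G.ball z.1 r → v ∈ G.ball x.1 (r + 1) := by
      intro v hv
      obtain ⟨p, hp⟩ := mem_ball_iff.mp hv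
      exact mem_ball_iff.mpr ⟨.cons hstep.adj p, Nat.succ_le_succ hp⟩
    rw [ih (r := r) (by simpa using hr) (fun h => ha (hball _ h)) h]
    have hx : x.1 ≠ a := fun h => ha (h ▸ mem_ball_self _ _)
    have hz : z.1 ≠ a := fun h => ha (hball _ (h ▸ mem_ball_self _ _))
    rcases hadj with hadj | hadj
    · rw [hadj.2, cyclicPerm, if_neg fun h => hx h.1]
      rfl
    · rw [hadj.2, cyclicPerm, if_neg fun h => hz h.1]
      rfl

/-- The cyclic lift along an arc that is not a bridge is connected. -/
theorem connected_cyclicLift {a b : G.V} (hG : G.graph.Connected) (hab : P.Arc a b)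
    (hbridge : ¬ G.graph.IsBridge s(a, b)) (m : ℕ) :
    (P.cyclicLift a b m).graph.Connected := by
  have hdel := hG.connected_delete_edge_of_not_isBridge hbridge
  have hlevel : ∀ (j : Fin (m + 1)) {u v : G.V}, (G.graph.deleteEdges {s(a, b)}).Walk u v →
      (P.cyclicLift a b m).graph.Reachable (u, j) (v, j) := by
    intro j u v p
    induction p with
    | nil => exact .rfl
    | @cons u v w h p ih =>
      refine .trans (SimpleGraph.Adj.reachable ?_) ih
      rw [SimpleGraph.deleteEdges_adj, Set.mem_singleton_iff, Sym2.eq_iff, not_or] at h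
      rcases P.orient u v h.1 with ho | ho
      · refine Or.inl ⟨ho.1, ?_⟩
        show j = cyclicPerm a b m u v j
        rw [cyclicPerm, if_neg h.2.1]
        rfl
      · refine Or.inr ⟨ho.1, ?_⟩
        show j = cyclicPerm a b m v u j
        rw [cyclicPerm, if_neg fun hh => h.2.2 hh.symm]
        rfl
  have hlevel' : ∀ (j : Fin (m + 1)) (u v : G.V),
      (P.cyclicLift a b m).graph.Reachable (u, j) (v, j) := fun j u v =>
    (hdel.preconnected u v).elim fun p => hlevel j p
  -- The arc above the one from `a` to `b` leads from level `j` to level `j + 1`; from its end one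
  -- returns to `a` within that level, which stays connected since the edge is not a bridge.
  have hzero : ∀ j : Fin (m + 1), (P.cyclicLift a b m).graph.Reachable (a, 0) (a, j) := by
    intro j
    induction j using Fin.induction with
    | zero => exact .rfl
    | succ i ih =>
      refine ih.trans (.trans (SimpleGraph.Adj.reachable (v := (b, i.succ)) ?_)
        (hlevel' i.succ b a))
      refine Or.inl ⟨hab, ?_⟩
      show i.succ = cyclicPerm a b m a b i.castSucc
      rw [cyclicPerm, if_pos ⟨rfl, rfl⟩, Equiv.coe_addRight]
      exact Fin.coeSucc_eq_succ.symm
  rw [SimpleGraph.connected_iff_exists_forall_reachable]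
  exact ⟨(a, 0), fun ⟨v, j⟩ => (hzero j).trans (hlevel' j a v)⟩

end PortsAndOrientation

/-! ### Components, and lifts inside the family -/

namespace FinGraph

/-- The graph induced by a connected component. -/
def component (H : FinGraph) (c : H.graph.ConnectedComponent) : FinGraph where
  V := c
  graph := c.toSimpleGraph

theorem isCovering_component {H G : FinGraph} {φ : H.V → G.V} (h : IsCovering H G φ)
    (hG : G.graph.Connected) (c : H.graph.ConnectedComponent) :
    IsCovering (H.component c) G (fun x : c => φ x.1) := by
  have hbij : ∀ x : c, Set.BijOn (fun x : c => φ x.1) ((H.component c).nbrs x)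
      (G.nbrs (φ x.1)) := by
    intro x
    refine ⟨fun y hy => h.map_adj hy, fun y hy z hz hyz =>
      Subtype.ext (h.eq_of_adj hy hz hyz), fun v hv => ?_⟩
    obtain ⟨y, hy, rfl⟩ := h.exists_adj hv
    exact ⟨⟨y, c.mem_supp_of_adj_mem_supp x.2 hy⟩, hy, rfl⟩
  refine ⟨fun v => ?_, hbij⟩
  obtain ⟨x⟩ := (c.connected_toSimpleGraph).nonempty
  obtain ⟨p⟩ := hG.preconnected (φ x.1) v
  have : ∀ {u v : G.V}, G.graph.Walk u v → (∃ x : c, φ x.1 = u) → ∃ x : c, φ x.1 = v := by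
    intro u v p
    induction p with
    | nil => exact id
    | cons hadj p ih =>
      rintro ⟨x, rfl⟩
      obtain ⟨y, -, hy⟩ := (hbij x).surjOn hadj
      exact ih ⟨y, hy⟩
  exact this p ⟨x, rfl⟩

/-- Some component has at most the average density of a given set. -/
theorem exists_component_density_le (H : FinGraph) [Nonempty H.V] (p : H.V → Prop) {ε : ℝ}
    (hp : ({x | p x}.ncard : ℝ) ≤ ε * Nat.card H.V) :
    ∃ c : H.graph.ConnectedComponent,
      ({x : (H.component c).V | p x.1}.ncard : ℝ) ≤ ε * Nat.card (H.component c).V := by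
  classical
  have := Fintype.ofFinite H.V
  have := Fintype.ofFinite H.graph.ConnectedComponent
  by_contra! hlt
  have hcard : ∀ q : H.V → Prop, {x | q x}.ncard =
      ∑ c : H.graph.ConnectedComponent, {x : c | q x.1}.ncard := by
    intro q
    rw [Set.ncard_eq_toFinset_card', Finset.card_eq_sum_card_fiberwise
      (f := H.graph.connectedComponentMk) (t := Finset.univ) fun _ _ => Finset.mem_univ _]
    refine Finset.sum_congr rfl fun c _ => ?_
    rw [← Set.InjOn.ncard_image (f := Subtype.val) Subtype.val_injective.injOn,
      ← Set.ncard_coe_finset]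
    congr 1
    ext x
    simp only [Finset.coe_filter, Set.mem_toFinset, Set.mem_image, Set.mem_ofPred_eq]
    constructor
    · rintro ⟨hx, hc⟩
      exact ⟨⟨x, hc⟩, hx, rfl⟩
    · rintro ⟨y, hy, rfl⟩
      exact ⟨hy, y.2⟩
  have h1 := hcard p
  have h2 := hcard fun _ => True
  have h3 : {x : H.V | True}.ncard = Nat.card H.V := Set.ncard_univ _
  have h4 : ∀ c : H.graph.ConnectedComponent, {x : c | True}.ncard =
    Nat.card (H.component c).V := fun c => Set.ncard_univ _
  simp only [h3, h4] at h2
  rw [h1, h2] at hp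
  push_cast at hp
  rw [Finset.mul_sum] at hp
  refine absurd hp (not_le.mpr (Finset.sum_lt_sum_of_nonempty ?_ fun c _ => hlt c))
  exact ⟨H.graph.connectedComponentMk (Classical.arbitrary _), Finset.mem_univ _⟩

/-- The families of graphs to which the theorem applies. -/
def IsLiftFamily (F : Set FinGraph) : Prop :=
  ClosedUnderLifts F ∨ ((∀ G ∈ F, G.graph.Connected) ∧ (∀ G ∈ F, ¬ G.graph.IsTree) ∧
    ClosedUnderConnectedLifts F)

theorem IsLiftFamily.exists_cyclicLift_mem {F : Set FinGraph} (hF : IsLiftFamily F)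
    {G : FinGraph} (hG : G ∈ F) [Nonempty G.V] (P : PortsAndOrientation G) :
    ∃ a b : G.V, ∀ m, P.cyclicLift a b m ∈ F := by
  rcases hF with hF | ⟨hconn, htree, hF⟩
  · obtain ⟨a⟩ := ‹Nonempty G.V›
    -- With `a = b` no arc is distinguished, and the lift is a disjoint union of `m + 1` copies of
    -- `G`.
    exact ⟨a, a, fun m => hF G hG _ ⟨_, P.isCovering_cyclicLift a a m⟩⟩
  · have hGc := hconn G hG
    -- A connected graph that is not a tree has a cycle, and the edges of a cycle are not bridges.
    have hac : ¬ G.graph.IsAcyclic := fun h => htree G hG ⟨hGc, h⟩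
    rw [SimpleGraph.isAcyclic_iff_forall_adj_isBridge] at hac
    push Not at hac
    obtain ⟨u, v, huv, hb⟩ := hac
    obtain ⟨a, b, hab, hb⟩ : ∃ a b, P.Arc a b ∧ ¬ G.graph.IsBridge s(a, b) := by
      rcases P.orient u v huv with h | h
      · exact ⟨u, v, h.1, hb⟩
      · exact ⟨v, u, h.1, by rwa [Sym2.eq_swap]⟩
    exact ⟨a, b, fun m => hF G hG _ hGc (connected_cyclicLift hGc hab hb m)
      ⟨_, P.isCovering_cyclicLift a b m⟩⟩

/-- A lift in which most nodes see a homogeneous ordering. -/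
theorem IsLiftFamily.exists_homogeneous_lift {F : Set FinGraph} (hF : IsLiftFamily F)
    {G : FinGraph} (hG : G ∈ F) [Nonempty G.V] (P : PortsAndOrientation G) {D : Type}
    [Fintype D] [Nonempty D] (π : ℕ × ℕ → Equiv.Perm D) (good : Finset D) {ε : ℝ}
    (hgood : (1 - ε) * (Fintype.card D : ℝ) ≤ good.card) :
    ∃ C ∈ F, ∃ (ψ : C.V → G.V) (hψ : IsCovering C G ψ) (N : ℕ) (d : C.V → D),
      HasFibres ψ N ∧
      (∀ w x y, (P.pullback hψ).IsWalk x w y → d y = runPerm π w (d x)) ∧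
      ({x | d x ∉ good}.ncard : ℝ) ≤ ε * Nat.card C.V := by
  classical
  set H := P.permLift D fun u v => π (P.label u v) with hH
  have hcov : IsCovering H G (Prod.fst : G.V × D → G.V) := P.isCovering_permLift _
  have hbad : ({x : G.V × D | x.2 ∉ good}.ncard : ℝ) ≤ ε * Nat.card (G.V × D) := by
    have hset : {x : G.V × D | x.2 ∉ good} = (Set.univ : Set G.V) ×ˢ ((goodᶜ : Finset D) : Set D) := by
      ext x
      simp
    rw [hset, Set.ncard_prod, Set.ncard_univ, Set.ncard_coe_finset, Nat.card_prod,
      Nat.card_eq_fintype_card (α := D), Finset.card_compl]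
    push_cast [Nat.cast_sub (Finset.card_le_univ good)]
    have : (0 : ℝ) ≤ Nat.card G.V := Nat.cast_nonneg _
    nlinarith
  rcases hF with hF | ⟨hconn, htree, hF⟩
  · exact ⟨H, hF G hG H ⟨_, hcov⟩, _, hcov, _, Prod.snd, hasFibres_fst,
      fun w x y h => isWalk_permLift_label π h, hbad⟩
  · have : Nonempty H.V := inferInstanceAs (Nonempty (G.V × D))
    -- The permutation lift may be disconnected; some component has no more than the average share
    -- of bad nodes, and it is a lift of `G` by itself.
    obtain ⟨c, hc⟩ := H.exists_component_density_le (fun x : G.V × D => x.2 ∉ good) hbad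
    have hcov' := isCovering_component hcov (hconn G hG) c
    obtain ⟨N, hN⟩ := hcov'.hasFibres (hconn G hG)
    refine ⟨H.component c, hF G hG _ (hconn G hG) c.connected_toSimpleGraph ⟨_, hcov'⟩, _, hcov',
      N, fun x => x.1.2, hN, ?_, hc⟩
    intro w x y h
    have hwalk : (P.pullback hcov).IsWalk x.1 w y.1 := by
      induction w generalizing x with
      | nil => exact congrArg Subtype.val h
      | cons a w ih =>
        obtain ⟨z, hz, h⟩ := h
        obtain ⟨hadj, hstep⟩ := pullback_step.mp hz
        exact ⟨z.1, pullback_step.mpr ⟨hadj, hstep⟩, ih z h⟩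
    exact isWalk_permLift_label π hwalk

end FinGraph

/-! ### Identifiers on the lift, and agreement of the two algorithms -/

/-- Identifiers of a cyclic lift, where each level has its own block of identifiers. -/
noncomputable def blockIdentifiers {s : ℕ → ℕ} {C : FinGraph} (P : PortsAndOrientation C)
    (a b : C.V) {m t : ℕ} (σ : C.V ≃ Fin t) (T : Fin (m + 1) → Finset ℕ)
    (hcard : ∀ j, (T j).card = t) (hT : ∀ j, T j ⊆ Finset.Icc 1 (s (t * (m + 1))))
    (hdis : Pairwise fun i j => Disjoint (T i) (T j)) :
    Identifiers s (P.cyclicLift a b m) where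
  id := fun x : C.V × Fin (m + 1) => (T x.2).orderEmbOfFin (hcard x.2) (σ x.1)
  injective := by
    rintro ⟨c, j⟩ ⟨c', j'⟩ h
    have h : (T j).orderEmbOfFin (hcard j) (σ c) = (T j').orderEmbOfFin (hcard j') (σ c') := h
    have hj : j = j' := by
      by_contra hne
      have h1 := (T j).orderEmbOfFin_mem (hcard j) (σ c)
      rw [h] at h1
      exact Finset.disjoint_left.mp (hdis hne) h1 ((T j').orderEmbOfFin_mem (hcard j') (σ c'))
    subst hj
    exact Prod.ext (σ.injective (((T j).orderEmbOfFin (hcard j)).injective h)) rfl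
  mem_Icc := by
    rintro ⟨c, j⟩
    have hn : Nat.card (P.cyclicLift a b m).V = t * (m + 1) := by
      rw [card_cyclicLift, Nat.card_congr σ, Nat.card_fin]
    rw [hn, ← Finset.coe_Icc]
    exact hT j ((T j).orderEmbOfFin_mem (hcard j) (σ c))

/-- Sorting by `d`, with ties broken arbitrarily; distinct nodes of a lift may share a point of `D`.
-/
theorem exists_equiv_fin_strictMono {α D : Type} [Finite α] [LinearOrder D] (d : α → D) :
    ∃ σ : α ≃ Fin (Nat.card α), ∀ x y, d x < d y → σ x < σ y := by
  let e := (Finite.equivFin α).symm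
  let τ := Tuple.sort (d ∘ e)
  have hmono : Monotone ((d ∘ e) ∘ τ) := Tuple.monotone_sort (d ∘ e)
  refine ⟨(τ.trans e).symm, fun x y hxy => ?_⟩
  by_contra hlt
  have := hmono (not_lt.mp hlt)
  have hx : ∀ z, ((d ∘ e) ∘ τ) ((τ.trans e).symm z) = d z := fun z =>
    congrArg d ((τ.trans e).apply_symm_apply z)
  rw [hx, hx] at this
  exact absurd hxy (not_lt.mpr this)

/-- Far from `a`, all short walks stay on the level `j`, where identifiers come from a single
monochromatic block and increase with `d`. At a good node the values of `d` along walks are distinct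
for distinct words and are ordered by `lt`. -/
theorem labelsMatch_blockIdentifiers {s : ℕ → ℕ} {C : FinGraph} {P : PortsAndOrientation C}
    {a b : C.V} {m t : ℕ} {σ : C.V ≃ Fin t} {T : Fin (m + 1) → Finset ℕ}
    {hcard : ∀ j, (T j).card = t} {hT : ∀ j, T j ⊆ Finset.Icc 1 (s (t * (m + 1)))}
    {hdis : Pairwise fun i j => Disjoint (T i) (T j)} {Δ : ℕ} {k : SolutionKind}
    [Inhabited (k.Label Δ)] {A : IDAlgorithm (k.Label Δ)}
    {lt : List Letter → List Letter → Prop}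
    {c : (boundedWords Δ A.radius).powerset → k.Label Δ}
    (hmono : ∀ j, IsMonochromatic lt A (T j) c)
    (hΔ : ∀ u : (P.cyclicLift a b m).V, (P.cyclicLift a b m).deg u ≤ Δ)
    {D : Type} [LinearOrder D] {π : ℕ × ℕ → Equiv.Perm D} {d : C.V → D}
    (hσ : ∀ x y, d x < d y → σ x < σ y)
    (hwalk : ∀ w x y, P.IsWalk x w y → d y = runPerm π w (d x))
    {x : C.V} (hgood : ∀ w ∈ boundedWords Δ (A.radius + 1), ∀ w' ∈ boundedWords Δ (A.radius + 1),
      (lt w w' ↔ runPerm π w (d x) < runPerm π w' (d x)) ∧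
        (runPerm π w (d x) = runPerm π w' (d x) → w = w'))
    (hfar : a ∉ C.ball x (A.radius + 1)) (j : Fin (m + 1)) :
    LabelsMatch Δ (P.cyclicLift a b m) (blockIdentifiers P a b σ T hcard hT hdis).port
      (P.pullback (P.isCovering_cyclicLift a b m)).port k
      (A.run (blockIdentifiers P a b σ T hcard hT hdis) (x, j))
      ((simulation lt A c).run (P.pullback (P.isCovering_cyclicLift a b m)) (fun _ => ()) (x, j))
      (x, j) := by
  set Q := P.pullback (P.isCovering_cyclicLift a b m) with hQ
  have hbw := Q.words_subset_boundedWords hΔ (A.radius + 1) (x, j)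
  have hend : ∀ w ∈ Q.words (A.radius + 1) (x, j), ∀ v : C.V × Fin (m + 1),
      Q.IsWalk (x, j) w v → d v.1 = runPerm π w (d x) ∧ v.2 = j := fun w hw v hv =>
    ⟨hwalk w x v.1 (hv.map), isWalk_cyclicLift (x := (x, j)) (y := v) hw.2.1 hfar hv⟩
  have hinj : ∀ w ∈ Q.words (A.radius + 1) (x, j), ∀ w' ∈ Q.words (A.radius + 1) (x, j),
      ∀ v, Q.IsWalk (x, j) w v → Q.IsWalk (x, j) w' v → w = w' := fun w hw w' hw' v hv hv' =>
    (hgood w (hbw hw) w' (hbw hw')).2 ((hend w hw v hv).1.symm.trans (hend w' hw' v hv').1)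
  refine labelsMatch_simulation lt A (hmono j) hΔ _ Q ?_ hinj ?_
  · rintro w hw w' hw' ⟨v, i⟩ ⟨v', i'⟩ hv hv'
    obtain ⟨h1, hi⟩ := hend w hw _ hv
    obtain ⟨h2, hi'⟩ := hend w' hw' _ hv'
    rw [show i = j from hi, show i' = j from hi']
    have hid : (blockIdentifiers P a b σ T hcard hT hdis).id (v, j) <
        (blockIdentifiers P a b σ T hcard hT hdis).id (v', j) ↔ σ v < σ v' :=
      ((T j).orderEmbOfFin (hcard j)).lt_iff_lt
    have hg := hgood w (hbw hw) w' (hbw hw')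
    rw [hid, hg.1, ← h1, ← h2]
    refine ⟨hσ v v', fun h => ?_⟩
    -- Arbitrarily broken ties do no harm: equal values of `d` in this neighbourhood come from equal
    -- words, hence from the same node.
    rcases lt_trichotomy (d v) (d v') with h' | h' | h'
    · exact h'
    · obtain rfl := hg.2 (h1.symm.trans (h'.trans h2))
      have hvv' : v = v' := congrArg Prod.fst (hv.eq_right hv')
      rw [hvv'] at h
      exact absurd h (lt_irrefl _)
    · exact absurd h (hσ _ _ h').not_gt
  · rintro ⟨v, i⟩ hv
    obtain ⟨w, hw, hwv⟩ := Q.mem_ball_iff_exists_reduced.mp hv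
    obtain ⟨-, hi⟩ := hend w ⟨hw.1, hw.2.1.trans (Nat.le_succ _), hw.2.2⟩ _ hwv
    have hi : i = j := hi
    subst hi
    exact (T i).orderEmbOfFin_mem (hcard i) (σ v)

theorem exists_isMonochromatic {Δ : ℕ} {k : SolutionKind} [Finite (k.Label Δ)]
    (lt : List Letter → List Letter → Prop) (A : IDAlgorithm (k.Label Δ)) (t : ℕ) :
    ∃ R : ℕ, ∀ S : Finset ℕ, R ≤ S.card → ∃ T ⊆ S, T.card = t ∧ ∃ c, IsMonochromatic lt A T c := by
  classical
  obtain ⟨R, hR⟩ := ramsey_family (fun W : Finset (List Letter) => W.card)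
    (fun W U => outputOn lt A W U) (boundedWords Δ A.radius).powerset t
  refine ⟨R, fun S hS => ?_⟩
  obtain ⟨T, hT, hTc, h⟩ := hR S hS
  choose c hc using h
  exact ⟨T, hT, hTc, fun W => c W.1 W.2, fun W U hU hUc => hc W.1 W.2 U hU hUc⟩

instance SolutionKind.finite_label (k : SolutionKind) (Δ : ℕ) : Finite (k.Label Δ) := by
  cases k
  · exact inferInstanceAs (Finite Bool)
  · exact inferInstanceAs (Finite (Fin Δ → Bool))

instance SolutionKind.inhabited_label (k : SolutionKind) (Δ : ℕ) : Inhabited (k.Label Δ) :=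
  match k with
  | .nodes => ⟨false⟩
  | .edges => ⟨fun _ => false⟩

/-- Every `ID`-algorithm can be simulated by a `PO`-algorithm in the sense that every network has
a lift in which the two algorithms agree at all but a small fraction of the nodes. -/
theorem exists_simulation {s : ℕ → ℕ}
    (hs : Filter.Tendsto (fun n : ℕ => (s n : ℝ) / (n : ℝ)) Filter.atTop Filter.atTop)
    {Δ : ℕ} {F : Set FinGraph} (hΔ : DegreeBounded F Δ) (hF : IsLiftFamily F) {k : SolutionKind}
    (A : IDAlgorithm (k.Label Δ)) :
    ∃ B : POAlgorithm Unit (k.Label Δ), ∀ G ∈ F, ∀ (P : PortsAndOrientation G) (ε : ℝ), 0 < ε →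
      ∃ H ∈ F, ∃ (φ : H.V → G.V) (N : ℕ), IsCovering H G φ ∧ HasFibres φ N ∧
        ∃ ι : Identifiers s H,
          ({x | ¬ LabelsMatch Δ H ι.port (fun u v => P.port (φ u) (φ v)) k (A.run ι x)
            (B.run P (fun _ => ()) (φ x)) x}.ncard : ℝ) ≤ ε * Nat.card H.V := by
  classical
  obtain ⟨lt, hlt⟩ := exists_homogeneous_perms (boundedWords Δ (A.radius + 1))
    (fun w hw => (mem_boundedWords.mp hw).1) (fun w hw p hp => by
      rw [mem_boundedWords] at hw ⊢
      exact ⟨hw.1.infix hp.isInfix, hp.length_le.trans hw.2.1, fun a ha => hw.2.2 a (hp.subset ha)⟩)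
  obtain ⟨c, hc⟩ := exists_common_colour (Mono := fun T c => IsMonochromatic lt A T c)
    (fun T T' c hTT' hT W U hU hUc => hT W U (hU.trans hTT') hUc)
    (exists_isMonochromatic lt A) s hs
  refine ⟨simulation lt A c, fun G hG P ε hε => ?_⟩
  cases isEmpty_or_nonempty G.V with
  | inl hempty =>
    refine ⟨G, hG, id, 1, .id G, .id _, ⟨fun u => isEmptyElim u, fun u => isEmptyElim u,
      fun u => isEmptyElim u⟩, ?_⟩
    rw [Set.eq_empty_of_isEmpty {x | _}, Set.ncard_empty, Nat.cast_zero]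
    positivity
  | inr hne =>
    obtain ⟨a₁, b₁, hmem₁⟩ := hF.exists_cyclicLift_mem hG P
    -- A preliminary lift makes the graph so large that a ball of radius `A.radius + 1` is at most a
    -- fraction `ε / 2` of every further lift. The other half of `ε` is spent on the points of `D`
    -- that are not good.
    obtain ⟨m₁, hm₁⟩ := exists_nat_ge (2 * (Δ + 1 : ℝ) ^ (A.radius + 1) / ε)
    set G₁ := P.cyclicLift a₁ b₁ m₁ with hG₁
    have hcov₁ := P.isCovering_cyclicLift a₁ b₁ m₁
    set P₁ := P.pullback hcov₁ with hP₁
    obtain ⟨v₀⟩ := hne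
    have hne₁ : Nonempty G₁.V := ⟨((v₀, 0) : G.V × Fin (m₁ + 1))⟩
    obtain ⟨D, hD, hDord, π, good, hDpos, hgood, hhom⟩ := hlt (ε / 2) (half_pos hε)
    have hDne : Nonempty D := Fintype.card_pos_iff.mp hDpos
    obtain ⟨C, hCF, ψ, hψ, N₁, d, hfib, hwalk, hbad⟩ :=
      hF.exists_homogeneous_lift (hmem₁ m₁) P₁ π good hgood
    set PC := P₁.pullback hψ with hPC
    obtain ⟨x₀, -⟩ := hψ.1 hne₁.some
    have hneC : Nonempty C.V := ⟨x₀⟩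
    obtain ⟨a, b, hmem⟩ := hF.exists_cyclicLift_mem hCF PC
    obtain ⟨σ, hσ⟩ := exists_equiv_fin_strictMono d
    -- The block size is the number of nodes of `C`, one block for each level; as it divides `n`,
    -- the lift with `M` levels has exactly `n` nodes and may use the identifiers up to `s n`.
    obtain ⟨n, hn, ⟨M, hM⟩, T, hT, hdis⟩ := hc (Nat.card C.V) Nat.card_pos
    obtain ⟨m, rfl⟩ : ∃ m, M = m + 1 := ⟨M - 1, by
      rcases Nat.eq_zero_or_pos M with rfl | h
      · simp at hM; omega
      · omega⟩
    have hMn : m + 1 ≤ n := hM ▸ Nat.le_mul_of_pos_left _ Nat.card_pos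
    subst hM
    set H := PC.cyclicLift a b m with hH
    have hcovH := PC.isCovering_cyclicLift a b m
    let ι : Identifiers s H := blockIdentifiers PC a b σ (fun j => T (Fin.castLE hMn j))
      (fun j => (hT _).1) (fun j => (hT _).2.1)
      (fun i j hij => hdis ((Fin.castLE_injective hMn).ne hij))
    refine ⟨H, hmem m, _, _, hcov₁.comp (hψ.comp hcovH),
      HasFibres.comp hasFibres_fst (hfib.comp hasFibres_fst), ι, ?_⟩
    -- Disagreement at a node of `H` depends on its projection to `C`: that node is not good, or it
    -- is close to the arc where the levels are linked.
    set bad : Set C.V := {x | d x ∉ good} ∪ C.ball a (A.radius + 1) with hbaddef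
    have hsub : {x : C.V × Fin (m + 1) | ¬ LabelsMatch Δ H ι.port
        (fun u v => P.port ((ψ u.1).1) ((ψ v.1).1)) k (A.run ι x)
        ((simulation lt A c).run P (fun _ => ()) (ψ x.1).1) x} ⊆ bad ×ˢ Set.univ := by
      rintro ⟨x, j⟩ hx
      refine ⟨?_, Set.mem_univ _⟩
      by_contra hxbad
      rw [hbaddef, Set.mem_union, not_or, Set.mem_ofPred_eq, not_not] at hxbad
      apply hx
      have := labelsMatch_blockIdentifiers (P := PC) (a := a) (b := b) (σ := σ)
        (T := fun j => T (Fin.castLE hMn j)) (hcard := fun j => (hT _).1)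
        (hT := fun j => (hT _).2.1)
        (hdis := fun i j hij => hdis ((Fin.castLE_injective hMn).ne hij)) (A := A)
        (fun j => (hT _).2.2) (hΔ H (hmem m)) hσ hwalk (hhom _ hxbad.1)
        (fun h => hxbad.2 (mem_ball_comm.mp h)) j
      have hrun : (simulation lt A c).run (PC.pullback hcovH) (fun _ => ()) (x, j) =
          (simulation lt A c).run P (fun _ => ()) (ψ x).1 := by
        simp only [POAlgorithm.run]
        congr 1
        exact (pullback_view (P := PC) (h := hcovH) (fun _ => ()) _ (x, j)).trans
          ((pullback_view (P := P₁) (h := hψ) (fun _ => ()) _ x).trans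
            (pullback_view (P := P) (h := hcov₁) (fun _ => ()) _ (ψ x)))
      rw [hrun] at this
      exact this
    have hcardC : (m₁ + 1 : ℝ) ≤ Nat.card C.V := by
      have h1 : Nat.card G₁.V ≤ Nat.card C.V := Nat.card_le_card_of_surjective ψ hψ.1
      rw [card_cyclicLift] at h1
      have h2 : m₁ + 1 ≤ Nat.card G.V * (m₁ + 1) :=
        Nat.le_mul_of_pos_left _ (Nat.card_pos_iff.mpr ⟨⟨v₀⟩, inferInstance⟩)
      exact_mod_cast h2.trans h1
    have hball : ((C.ball a (A.radius + 1)).ncard : ℝ) ≤ ε / 2 * Nat.card C.V := by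
      have h1 : ((C.ball a (A.radius + 1)).ncard : ℝ) ≤ (Δ + 1 : ℝ) ^ (A.radius + 1) := by
        exact_mod_cast ncard_ball_le (hΔ C hCF) (A.radius + 1) a
      rw [div_le_iff₀ hε] at hm₁
      have h2 : (m₁ : ℝ) * ε ≤ Nat.card C.V * ε := by
        apply mul_le_mul_of_nonneg_right _ hε.le
        linarith
      linarith
    have hbadcard : (bad.ncard : ℝ) ≤ ε * Nat.card C.V := by
      have : (bad.ncard : ℝ) ≤ ({x | d x ∉ good}.ncard : ℝ) + (C.ball a (A.radius + 1)).ncard := by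
        exact_mod_cast Set.ncard_union_le _ _
      linarith
    have hle := Set.ncard_le_ncard hsub (Set.toFinite _)
    rw [Set.ncard_prod, Set.ncard_univ, Nat.card_fin] at hle
    have hcardH : Nat.card H.V = Nat.card C.V * (m + 1) := card_cyclicLift _ _ _ _
    calc _ ≤ ((bad.ncard * (m + 1) : ℕ) : ℝ) := by exact_mod_cast hle
      _ ≤ ε * Nat.card C.V * (m + 1) := by
        push_cast
        exact mul_le_mul_of_nonneg_right hbadcard (by positivity)
      _ = _ := by rw [hcardH]; push_cast; ring

/-! ### Solutions, their lifts and their sizes -/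

section Solutions

variable {Δ : ℕ} {G H : FinGraph}

/-- The part of a solution that is visible at the node `u`. -/
def localSolution (G : FinGraph) : (k : SolutionKind) → Set (k.Item G) → G.V → Set G.V
  | .nodes, X, u => {v | v = u ∧ u ∈ X}
  | .edges, X, u => {v | ∃ h : G.graph.Adj u v, ⟨s(u, v), h⟩ ∈ X}

/-- The solution on a lift that corresponds to a solution on the base graph. -/
def liftSolution (φ : H.V → G.V) : (k : SolutionKind) → Set (k.Item G) → Set (k.Item H)
  | .nodes, X => φ ⁻¹' X
  | .edges, X => {e | Sym2.map φ e.1 ∈ Subtype.val '' X}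

theorem mem_liftSolution_edges {φ : H.V → G.V} (hφ : IsCovering H G φ)
    {X : Set (SolutionKind.edges.Item G)} {u v : H.V} (h : H.graph.Adj u v) :
    (⟨s(u, v), h⟩ : H.graph.edgeSet) ∈ liftSolution φ .edges X ↔
      (⟨s(φ u, φ v), hφ.map_adj h⟩ : G.graph.edgeSet) ∈ X := by
  constructor
  · rintro ⟨e, he, heq⟩
    have : e = ⟨s(φ u, φ v), hφ.map_adj h⟩ := Subtype.ext heq
    rwa [← this]
  · intro he
    exact ⟨_, he, rfl⟩

theorem Describes.liftSolution {φ : H.V → G.V} (hφ : IsCovering H G φ) {p : G.V → G.V → ℕ}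
    {k : SolutionKind} {x : G.V → k.Label Δ} {X : Set (k.Item G)} (h : Describes Δ G p k x X) :
    Describes Δ H (fun u v => p (φ u) (φ v)) k (x ∘ φ) (liftSolution φ k X) := by
  cases k with
  | nodes => exact fun u => h (φ u)
  | edges =>
    intro u v huv i hi
    rw [mem_liftSolution_edges hφ]
    exact h _ _ (hφ.map_adj huv) i hi

theorem localSolution_liftSolution {φ : H.V → G.V} (hφ : IsCovering H G φ) (k : SolutionKind)
    (X : Set (k.Item G)) (u : H.V) : Set.BijOn φ (localSolution H k (liftSolution φ k X) u)
      (localSolution G k X (φ u)) := by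
  cases k with
  | nodes =>
    refine ⟨?_, ?_, ?_⟩
    · rintro v ⟨rfl, hv⟩
      exact ⟨rfl, hv⟩
    · rintro v ⟨rfl, -⟩ w ⟨rfl, -⟩ -
      rfl
    · rintro v ⟨rfl, hv⟩
      exact ⟨u, ⟨rfl, hv⟩, rfl⟩
  | edges =>
    refine ⟨?_, ?_, ?_⟩
    · rintro v ⟨huv, hv⟩
      exact ⟨_, (mem_liftSolution_edges hφ huv).mp hv⟩
    · rintro v ⟨huv, -⟩ w ⟨huw, -⟩ heq
      exact hφ.eq_of_adj huv huw heq
    · rintro v ⟨huv, hv⟩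
      obtain ⟨v', huv', rfl⟩ := hφ.exists_adj huv
      exact ⟨v', ⟨huv', (mem_liftSolution_edges hφ huv').mpr hv⟩, rfl⟩

theorem encode_congr {p : G.V → G.V → ℕ} {k : SolutionKind} {X Y : Set (k.Item G)} {u : G.V}
    (h : localSolution G k X u = localSolution G k Y u) :
    encode Δ G p k X u = encode Δ G p k Y u := by
  cases k with
  | nodes =>
    have h1 : u ∈ localSolution G .nodes X u ↔ u ∈ localSolution G .nodes Y u := by rw [h]
    have h2 : u ∈ X ↔ u ∈ Y := by simpa [localSolution] using h1
    exact decide_eq_decide.mpr h2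
  | edges =>
    have h1 : ∀ v, (∃ h : G.graph.Adj u v, (⟨s(u, v), h⟩ : G.graph.edgeSet) ∈ X) ↔
        ∃ h : G.graph.Adj u v, (⟨s(u, v), h⟩ : G.graph.edgeSet) ∈ Y := fun v => by
      have : v ∈ localSolution G .edges X u ↔ v ∈ localSolution G .edges Y u := by rw [h]
      exact this
    funext i
    simp only [encode]
    congr 1
    refine propext (exists_congr fun v => ?_)
    rw [exists_and_left, exists_and_left, h1]

theorem encode_liftSolution {φ : H.V → G.V} (hφ : IsCovering H G φ) (p : G.V → G.V → ℕ)
    (k : SolutionKind) (X : Set (k.Item G)) :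
    encode Δ H (fun u v => p (φ u) (φ v)) k (liftSolution φ k X) = encode Δ G p k X ∘ φ := by
  cases k with
  | nodes => rfl
  | edges =>
    funext u i
    simp only [encode, Function.comp_apply]
    congr 1
    refine propext ⟨?_, ?_⟩
    · rintro ⟨v, huv, hi, hv⟩
      exact ⟨φ v, hφ.map_adj huv, hi, (mem_liftSolution_edges hφ huv).mp hv⟩
    · rintro ⟨v, huv, hi, hv⟩
      obtain ⟨v', huv', rfl⟩ := hφ.exists_adj huv
      exact ⟨v', huv', hi, (mem_liftSolution_edges hφ huv').mpr hv⟩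

/-- The bounds on `p` and `q` ensure that every incident edge has a component in both labels, so
matching labels settle all incident edges. -/
theorem localSolution_eq_of_labelsMatch {p q : G.V → G.V → ℕ} {k : SolutionKind}
    {x y : G.V → k.Label Δ} {X Y : Set (k.Item G)} (hX : Describes Δ G p k x X)
    (hY : Describes Δ G q k y Y) (hp : ∀ u v, G.graph.Adj u v → p u v < Δ)
    (hq : ∀ u v, G.graph.Adj u v → q u v < Δ) {u : G.V}
    (h : LabelsMatch Δ G p q k (x u) (y u) u) :
    localSolution G k X u = localSolution G k Y u := by
  cases k with
  | nodes =>
    have h : x u = y u := h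
    have h1 : u ∈ X ↔ u ∈ Y := by rw [← hX u, ← hY u, h]
    simp only [localSolution, h1]
  | edges =>
    ext v
    refine exists_congr fun huv => ?_
    have := h v huv ⟨_, hp u v huv⟩ ⟨_, hq u v huv⟩ rfl rfl
    rw [← hX u v huv ⟨_, hp u v huv⟩ rfl, ← hY u v huv ⟨_, hq u v huv⟩ rfl, this]

/-- A family of labels describes a solution if it does so locally in some lift around each edge. -/
theorem exists_describes {P : PortsAndOrientation G} {k : SolutionKind} {x : G.V → k.Label Δ}
    (hx : ∀ u v, G.graph.Adj u v → ∃ (H : FinGraph) (φ : H.V → G.V) (u' v' : H.V)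
      (q : H.V → H.V → ℕ) (y : H.V → k.Label Δ) (Y : Set (k.Item H)), H.graph.Adj u' v' ∧
      φ u' = u ∧ φ v' = v ∧ Describes Δ H q k y Y ∧ (∀ a b, H.graph.Adj a b → q a b < Δ) ∧
      LabelsMatch Δ H q (fun a b => P.port (φ a) (φ b)) k (y u') (x u) u' ∧
      LabelsMatch Δ H q (fun a b => P.port (φ a) (φ b)) k (y v') (x v) v') :
    ∃ X, Describes Δ G P.port k x X := by
  cases k with
  | nodes => exact ⟨{u | x u = true}, fun u => Iff.rfl⟩
  | edges =>
    -- Both endpoints have to agree about an edge. They do so in the lift, where the labels describe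
    -- a solution, and matching carries this down to `G`.
    have hcons : ∀ u v, G.graph.Adj u v → ∀ i j : Fin Δ, (i : ℕ) = P.port u v →
        (j : ℕ) = P.port v u → x u i = x v j := by
      intro u v huv i j hi hj
      obtain ⟨H, φ, u', v', q, y, Y, hadj, rfl, rfl, hY, hq, hu, hv⟩ := hx u v huv
      rw [← hu v' hadj ⟨_, hq u' v' hadj⟩ i rfl hi, ← hv u' hadj.symm ⟨_, hq v' u' hadj.symm⟩ j
        rfl hj, Bool.eq_iff_iff, hY u' v' hadj _ rfl, hY v' u' hadj.symm _ rfl]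
      have : (⟨s(u', v'), hadj⟩ : H.graph.edgeSet) = ⟨s(v', u'), hadj.symm⟩ :=
        Subtype.ext Sym2.eq_swap
      rw [this]
    refine ⟨{e | ∃ u v, e.1 = s(u, v) ∧ ∃ i : Fin Δ, (i : ℕ) = P.port u v ∧ x u i = true}, ?_⟩
    intro u v huv i hi
    constructor
    · exact fun h => ⟨u, v, rfl, i, hi, h⟩
    · rintro ⟨a, b, hab, j, hj, h⟩
      rcases Sym2.eq_iff.mp hab with ⟨rfl, rfl⟩ | ⟨rfl, rfl⟩
      · rwa [Fin.ext (hi.trans hj.symm)]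
      · rwa [hcons u v huv i j hi hj]

/-- The number of times that each element of a solution is seen. -/
def SolutionKind.multiplicity : SolutionKind → ℕ
  | .nodes => 1
  | .edges => 2

theorem sum_ncard_localSolution [Fintype G.V] (k : SolutionKind) (X : Set (k.Item G)) :
    ∑ u, (localSolution G k X u).ncard = k.multiplicity * X.ncard := by
  classical
  cases k with
  | nodes =>
    have h1 : ∀ u, (localSolution G .nodes X u).ncard = if u ∈ X then 1 else 0 := by
      intro u
      split_ifs with hu
      · have : localSolution G .nodes X u = {u} := by
          ext v
          simp [localSolution, hu]
        rw [this, Set.ncard_singleton]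
      · have : localSolution G .nodes X u = ∅ := by
          ext v
          simp [localSolution, hu]
        rw [this, Set.ncard_empty]
    simp only [h1, SolutionKind.multiplicity, one_mul]
    rw [Finset.sum_boole, Nat.cast_id, ← Set.ncard_coe_finset]
    congr 1
    ext u
    simp
  | edges =>
    let K : SimpleGraph G.V := SimpleGraph.fromEdgeSet (Subtype.val '' X)
    have hK : K.edgeSet = Subtype.val '' X := by
      rw [SimpleGraph.edgeSet_fromEdgeSet, sdiff_eq_left, Set.disjoint_left]
      rintro _ ⟨e, -, rfl⟩ hdiag
      exact G.graph.not_isDiag_of_mem_edgeSet e.2 hdiag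
    have hdeg : ∀ u, (localSolution G .edges X u).ncard = K.degree u := by
      intro u
      rw [← SimpleGraph.card_neighborSet_eq_degree, ← Set.toFinset_card,
        ← Set.ncard_eq_toFinset_card']
      congr 1
      ext v
      rw [SimpleGraph.mem_neighborSet, ← SimpleGraph.mem_edgeSet, hK]
      constructor
      · rintro ⟨h, hX⟩
        exact ⟨_, hX, rfl⟩
      · rintro ⟨e, he, heq⟩
        have hadj : G.graph.Adj u v := by
          rw [← SimpleGraph.mem_edgeSet, ← heq]
          exact e.2
        refine ⟨hadj, ?_⟩
        have : e = ⟨s(u, v), hadj⟩ := Subtype.ext heq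
        rwa [← this]
    simp only [hdeg]
    rw [SimpleGraph.sum_degrees_eq_twice_card_edges, SimpleGraph.edgeFinset,
      ← Set.ncard_eq_toFinset_card', hK, Set.InjOn.ncard_image Subtype.val_injective.injOn]
    rfl

theorem ncard_localSolution_le (hG : ∀ u : G.V, G.deg u ≤ Δ) (k : SolutionKind)
    (X : Set (k.Item G)) (u : G.V) : (localSolution G k X u).ncard ≤ Δ + 1 := by
  have hsub : localSolution G k X u ⊆ insert u (G.nbrs u) := by
    cases k with
    | nodes =>
      rintro v ⟨rfl, -⟩
      exact Or.inl rfl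
    | edges =>
      rintro v ⟨h, -⟩
      exact Or.inr h
  exact (Set.ncard_le_ncard hsub (Set.toFinite _)).trans
    ((Set.ncard_insert_le _ _).trans (Nat.succ_le_succ (hG u)))

/-- Solutions that agree at most nodes have almost the same size. -/
theorem multiplicity_mul_ncard_le (hG : ∀ u : G.V, G.deg u ≤ Δ) {k : SolutionKind}
    {X Y : Set (k.Item G)} {bad : Set G.V}
    (h : ∀ u ∉ bad, localSolution G k X u = localSolution G k Y u) :
    k.multiplicity * X.ncard ≤ k.multiplicity * Y.ncard + (Δ + 1) * bad.ncard := by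
  classical
  have := Fintype.ofFinite G.V
  rw [← sum_ncard_localSolution, ← sum_ncard_localSolution, Set.ncard_eq_toFinset_card',
    mul_comm (Δ + 1), ← smul_eq_mul, ← Finset.sum_const, ← Finset.sum_filter_add_sum_filter_not
    Finset.univ (· ∈ bad), add_comm]
  refine add_le_add ?_ ?_
  · rw [Finset.sum_congr rfl fun u hu => by rw [h u (Finset.mem_filter.mp hu).2]]
    exact Finset.sum_le_sum_of_subset (Finset.filter_subset _ _)
  · rw [← Set.filter_mem_univ_eq_toFinset]
    exact Finset.sum_le_sum fun u _ => ncard_localSolution_le hG k X u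

/-- Double counting by local parts, each of which is mapped bijectively by the covering. -/
theorem ncard_liftSolution {φ : H.V → G.V} (hφ : IsCovering H G φ) {N : ℕ} (hN : HasFibres φ N)
    (k : SolutionKind) (X : Set (k.Item G)) : (liftSolution φ k X).ncard = N * X.ncard := by
  have := Fintype.ofFinite G.V
  have := Fintype.ofFinite H.V
  have hpos : 0 < k.multiplicity := by cases k <;> simp [SolutionKind.multiplicity]
  refine Nat.eq_of_mul_eq_mul_left hpos ?_
  rw [← sum_ncard_localSolution, mul_left_comm, ← sum_ncard_localSolution (G := G),
    ← hN.sum_comp fun v => (localSolution G k X v).ncard]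
  refine Finset.sum_congr rfl fun u _ => ?_
  have hb := localSolution_liftSolution hφ k X u
  rw [← hb.image_eq, hb.injOn.ncard_image]

theorem Identifiers.port_lt {s : ℕ → ℕ} (ι : Identifiers s G) (hG : ∀ u : G.V, G.deg u ≤ Δ)
    {u v : G.V} (h : G.graph.Adj u v) : ι.port u v < Δ := by
  refine (Set.ncard_lt_ncard (t := G.nbrs u) ⟨fun w hw => hw.1, fun hsub => ?_⟩
    (Set.toFinite _)).trans_le (hG u)
  exact lt_irrefl _ (hsub h).2

/-- If a set is much smaller than the fibres, then each fibre contains a node that is far from the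
set. -/
theorem exists_far_of_ncard_lt (hH : ∀ u : H.V, H.deg u ≤ Δ) {φ : H.V → G.V} {N : ℕ}
    (hN : HasFibres φ N) {bad : Set H.V} {r : ℕ} (hbad : bad.ncard * (Δ + 1) ^ r < N) (u : G.V) :
    ∃ u', φ u' = u ∧ ∀ v ∈ H.ball u' r, v ∉ bad := by
  classical
  have := Fintype.ofFinite H.V
  by_contra! hcon
  -- Otherwise the balls around the bad nodes would cover the fibre of `u`.
  have hsub : {u' | φ u' = u} ⊆ ⋃ v ∈ bad.toFinset, H.ball v r := by
    intro u' hu'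
    obtain ⟨v, hv, hvb⟩ := hcon u' hu'
    exact Set.mem_iUnion₂.mpr ⟨v, Set.mem_toFinset.mpr hvb, mem_ball_comm.mp hv⟩
  have h1 := (Set.ncard_le_ncard hsub (Set.toFinite _)).trans (Finset.set_ncard_biUnion_le _ _)
  rw [hN u] at h1
  have h2 := h1.trans (Finset.sum_le_card_nsmul _ _ _ fun v _ => ncard_ball_le hH r v)
  rw [smul_eq_mul, ← Set.ncard_eq_toFinset_card'] at h2
  omega

end Solutions

/-! ### Transfer of feasibility and of the approximation ratio -/

/-- On a family closed under taking this lift, feasibility of a solution can be tested on the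
lift. -/
theorem feasible_liftSolution_iff {Pi : SimpleGraphProblem} {Δ : ℕ} {F : Set FinGraph}
    {C : POAlgorithm (Pi.kind.Label Δ) Bool}
    (hC : ∀ G ∈ F, ∀ (P : PortsAndOrientation G) (X : Set (Pi.kind.Item G)),
      (Pi.Feasible G X → ∀ u : G.V, C.run P (encode Δ G P.port Pi.kind X) u = true) ∧
      (¬ Pi.Feasible G X → ∃ u : G.V, C.run P (encode Δ G P.port Pi.kind X) u = false))
    {G H : FinGraph} (hG : G ∈ F) (hH : H ∈ F) (P : PortsAndOrientation G) {φ : H.V → G.V}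
    (hφ : IsCovering H G φ) (X : Set (Pi.kind.Item G)) :
    Pi.Feasible H (liftSolution φ Pi.kind X) ↔ Pi.Feasible G X := by
  have hrun : ∀ u : H.V, C.run (P.pullback hφ)
      (encode Δ H (P.pullback hφ).port Pi.kind (liftSolution φ Pi.kind X)) u =
      C.run P (encode Δ G P.port Pi.kind X) (φ u) := by
    intro u
    have h1 : encode Δ H (P.pullback hφ).port Pi.kind (liftSolution φ Pi.kind X) =
        encode Δ G P.port Pi.kind X ∘ φ := encode_liftSolution hφ P.port Pi.kind X
    rw [h1, POAlgorithm.run, pullback_view, POAlgorithm.run]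
  constructor
  · intro h
    by_contra hcon
    obtain ⟨u, hu⟩ := (hC G hG P X).2 hcon
    obtain ⟨u', rfl⟩ := hφ.1 u
    rw [← hrun, (hC H hH _ _).1 h u'] at hu
    cases hu
  · intro h
    by_contra hcon
    obtain ⟨u, hu⟩ := (hC H hH (P.pullback hφ) _).2 hcon
    rw [hrun, (hC G hG _ _).1 h] at hu
    cases hu

/-- If the labels match at all nodes of a neighbourhood, then feasibility is passed from the
solution on the lift to the solution on the base graph. -/
theorem feasible_of_forall_exists_lift {Pi : SimpleGraphProblem} {Δ : ℕ} {F : Set FinGraph}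
    (hΔ : DegreeBounded F Δ) {C : POAlgorithm (Pi.kind.Label Δ) Bool}
    (hC : ∀ G ∈ F, ∀ (P : PortsAndOrientation G) (X : Set (Pi.kind.Item G)),
      (Pi.Feasible G X → ∀ u : G.V, C.run P (encode Δ G P.port Pi.kind X) u = true) ∧
      (¬ Pi.Feasible G X → ∃ u : G.V, C.run P (encode Δ G P.port Pi.kind X) u = false))
    {G : FinGraph} (hG : G ∈ F) (P : PortsAndOrientation G) {X : Set (Pi.kind.Item G)}
    {x : G.V → Pi.kind.Label Δ} (hX : Describes Δ G P.port Pi.kind x X)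
    (hlift : ∀ u, ∃ H ∈ F, ∃ (φ : H.V → G.V) (_ : IsCovering H G φ) (u' : H.V)
      (q : H.V → H.V → ℕ) (y : H.V → Pi.kind.Label Δ) (Y : Set (Pi.kind.Item H)),
      φ u' = u ∧ Describes Δ H q Pi.kind y Y ∧ (∀ a b, H.graph.Adj a b → q a b < Δ) ∧
      Pi.Feasible H Y ∧ ∀ v ∈ H.ball u' C.radius,
        LabelsMatch Δ H q (fun a b => P.port (φ a) (φ b)) Pi.kind (y v) (x (φ v)) v) :
    Pi.Feasible G X := by
  by_contra hcon
  obtain ⟨u, hu⟩ := (hC G hG P X).2 hcon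
  obtain ⟨H, hH, φ, hφ, u', q, y, Y, rfl, hY, hq, hfeas, hmatch⟩ := hlift u
  have hp : ∀ a b, H.graph.Adj a b → P.port (φ a) (φ b) < Δ := fun a b hab =>
    (P.port_lt_deg (hφ.map_adj hab)).trans_le (hΔ G hG _)
  have h1 := (hC H hH (P.pullback hφ) Y).1 hfeas u'
  have h2 : (P.pullback hφ).view (encode Δ H (P.pullback hφ).port Pi.kind Y) C.radius u' =
      P.view (encode Δ G P.port Pi.kind X) C.radius (φ u') := by
    -- Within the radius of the checker, the lift of `X` and `Y` have the same encodings. Hence the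
    -- checker accepts at the node below `u'`, as it does at `u'`.
    rw [← pullback_view (h := hφ)]
    refine view_congr fun v hv => ?_
    rw [← encode_liftSolution hφ P.port Pi.kind X]
    exact encode_congr (localSolution_eq_of_labelsMatch hY (hX.liftSolution hφ) hq hp (hmatch v hv))
  rw [POAlgorithm.run, h2] at h1
  rw [POAlgorithm.run, h1] at hu
  cases hu

/-- On the lift all sizes are scaled by `N`, up to an error `N * δ`; dividing by `N` and letting `δ`
tend to 0 gives the inequality on `G` with the same `α`. -/
theorem isApprox_of_forall_exists {Pi : SimpleGraphProblem} {α : ℝ} {G : FinGraph}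
    {X : Set (Pi.kind.Item G)} (hX : Pi.Feasible G X)
    (h : ∀ δ : ℝ, 0 < δ → ∃ (H : FinGraph) (Z : Set (Pi.kind.Item H)) (N : ℕ), 0 < N ∧
      Pi.IsApprox α H Z ∧ |(Z.ncard : ℝ) - N * X.ncard| ≤ N * δ ∧
      ∀ Y, Pi.Feasible G Y → ∃ Y', Pi.Feasible H Y' ∧ Y'.ncard = N * Y.ncard) :
    Pi.IsApprox α G X := by
  refine ⟨hX, fun Y hY => ?_⟩
  have key : ∀ δ : ℝ, 0 < δ → ∃ (N z : ℝ), 0 < N ∧ |z - N * X.ncard| ≤ N * δ ∧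
      match Pi.goal with
      | .minimise => z ≤ α * (N * Y.ncard)
      | .maximise => N * Y.ncard ≤ α * z := by
    intro δ hδ
    obtain ⟨H, Z, N, hN, hZ, hcard, hlift⟩ := h δ hδ
    obtain ⟨Y', hY', hYc⟩ := hlift Y hY
    refine ⟨N, Z.ncard, by exact_mod_cast hN, hcard, ?_⟩
    have := hZ.2 Y' hY'
    rw [hYc] at this
    push_cast at this
    exact this
  cases hgoal : Pi.goal with
  | minimise =>
    rw [hgoal] at key
    refine le_of_forall_pos_le_add fun δ hδ => ?_
    obtain ⟨N, z, hN, hz, hle⟩ := key δ hδ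
    have hz := (abs_le.mp hz).1
    refine le_of_mul_le_mul_left ?_ hN
    have hle : z ≤ α * (N * Y.ncard) := hle
    linarith
  | maximise =>
    rw [hgoal] at key
    refine le_of_forall_pos_le_add fun δ hδ => ?_
    have hpos : 0 < |α| + 1 := by positivity
    -- In a maximisation problem the error is multiplied by `α`, which may be of any sign or zero.
    obtain ⟨N, z, hN, hz, hle⟩ := key (δ / (|α| + 1)) (div_pos hδ hpos)
    have hle : N * Y.ncard ≤ α * z := hle
    refine le_of_mul_le_mul_left ?_ hN
    have h1 : α * (z - N * X.ncard) ≤ |α| * (N * (δ / (|α| + 1))) :=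
      (le_abs_self _).trans (by
        rw [abs_mul]
        exact mul_le_mul_of_nonneg_left hz (abs_nonneg _))
    have h2 : |α| * (δ / (|α| + 1)) ≤ δ := by
      rw [← mul_div_assoc, div_le_iff₀ hpos]
      nlinarith
    have h3 : |α| * (N * (δ / (|α| + 1))) ≤ N * δ := by
      calc _ = N * (|α| * (δ / (|α| + 1))) := by ring
        _ ≤ _ := mul_le_mul_of_nonneg_left h2 hN.le
    linarith

theorem theorem1 (s : ℕ → ℕ)
    (hs : Filter.Tendsto (fun n : ℕ => (s n : ℝ) / (n : ℝ)) Filter.atTop Filter.atTop)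
    (Δ : ℕ) (F : Set FinGraph) (hΔ : FinGraph.DegreeBounded F Δ)
    (hF : FinGraph.ClosedUnderLifts F ∨
      ((∀ G ∈ F, G.graph.Connected) ∧ (∀ G ∈ F, ¬ G.graph.IsTree) ∧
        FinGraph.ClosedUnderConnectedLifts F))
    (Pi : SimpleGraphProblem) (hPi : Pi.POCheckable Δ F) (α : ℝ)
    (hA : ∃ A : IDAlgorithm (Pi.kind.Label Δ), A.FindsApprox s Pi α F) :
    ∃ B : POAlgorithm Unit (Pi.kind.Label Δ), B.FindsApprox Pi α F := by
  obtain ⟨A, hA⟩ := hA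
  obtain ⟨C, hC⟩ := hPi
  obtain ⟨B, hB⟩ := exists_simulation hs hΔ hF A
  refine ⟨B, fun G hG P => ?_⟩
  set x := B.run P fun _ => () with hx
  -- in suitable lifts the algorithms agree in large neighbourhoods
  have hfar : ∀ (r : ℕ) (u : G.V), ∃ H ∈ F, ∃ (φ : H.V → G.V) (_ : IsCovering H G φ) (u' : H.V)
      (ι : Identifiers s H), φ u' = u ∧ ∀ v ∈ H.ball u' r,
        LabelsMatch Δ H ι.port (fun a b => P.port (φ a) (φ b)) Pi.kind (A.run ι v) (x (φ v)) v := by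
    intro r u
    have hVpos : 0 < Nat.card G.V := Nat.card_pos_iff.mpr ⟨⟨u⟩, inferInstance⟩
    have hVpos' : (0 : ℝ) < Nat.card G.V := by exact_mod_cast hVpos
    -- With the fraction `1 / c`, the balls of radius `r` around bad nodes contain at most `N / 2`
    -- nodes in total, fewer than a fibre has.
    set c : ℝ := 2 * (Δ + 1 : ℝ) ^ r * Nat.card G.V with hc
    have hcpos : 0 < c := by positivity
    obtain ⟨H, hH, φ, N, hφ, hN, ι, hbad⟩ := hB G hG P (1 / c) (by positivity)
    have hNpos : (0 : ℝ) < N := by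
      obtain ⟨u', hu'⟩ := hφ.1 u
      have : 0 < {w | φ w = u}.ncard := (Set.ncard_pos (Set.toFinite _)).mpr ⟨u', hu'⟩
      rw [hN u] at this
      exact_mod_cast this
    have hlt : {w | ¬ LabelsMatch Δ H ι.port (fun u v => P.port (φ u) (φ v)) Pi.kind (A.run ι w)
        (B.run P (fun _ => ()) (φ w)) w}.ncard * (Δ + 1) ^ r < N := by
      rw [hN.card_eq] at hbad
      have h1 := mul_le_mul_of_nonneg_right hbad (show (0 : ℝ) ≤ (Δ + 1 : ℝ) ^ r by positivity)
      have h2 : 1 / c * ((N * Nat.card G.V : ℕ) : ℝ) * (Δ + 1 : ℝ) ^ r = N / 2 := by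
        rw [hc]
        push_cast
        field_simp
      rw [h2] at h1
      have h3 := h1.trans_lt (half_lt_self hNpos)
      exact_mod_cast h3
    obtain ⟨u', hu', hu''⟩ := exists_far_of_ncard_lt (hΔ H hH) hN hlt u
    exact ⟨H, hH, φ, hφ, u', ι, hu', fun v hv => not_not.mp (hu'' v hv)⟩
  have hιport : ∀ H ∈ F, ∀ (ι : Identifiers s H) (a b : H.V), H.graph.Adj a b → ι.port a b < Δ :=
    fun H hH ι a b hab => ι.port_lt (hΔ H hH) hab
  obtain ⟨X, hX⟩ : ∃ X, Describes Δ G P.port Pi.kind x X := by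
    refine exists_describes fun u v huv => ?_
    obtain ⟨H, hH, φ, hφ, u', ι, rfl, hmatch⟩ := hfar 1 u
    obtain ⟨v', huv', rfl⟩ := hφ.exists_adj huv
    obtain ⟨Y, hY, -⟩ := hA H hH ι
    exact ⟨H, φ, u', v', ι.port, A.run ι, Y, huv', rfl, rfl, hY, hιport H hH ι,
      hmatch u' (mem_ball_self _ _), hmatch v' (mem_ball_iff.mpr ⟨huv'.toWalk, le_rfl⟩)⟩
  refine ⟨X, hX, isApprox_of_forall_exists ?_ fun δ hδ => ?_⟩
  · refine feasible_of_forall_exists_lift hΔ hC hG P hX fun u => ?_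
    obtain ⟨H, hH, φ, hφ, u', ι, rfl, hmatch⟩ := hfar C.radius u
    obtain ⟨Y, hY, hYa⟩ := hA H hH ι
    exact ⟨H, hH, φ, hφ, u', ι.port, A.run ι, Y, rfl, hY, hιport H hH ι, hYa.1, hmatch⟩
  -- At each bad node the local parts differ in size by at most `Δ + 1`, and `H` has `N * card V`
  -- nodes. The `+ 1` keeps `c` positive for the empty graph.
  · set c : ℝ := (Δ + 1 : ℝ) * (Nat.card G.V + 1) with hc
    have hcpos : 0 < c := by positivity
    obtain ⟨H, hH, φ, N, hφ, hN, ι, hbad⟩ := hB G hG P (δ / c) (by positivity)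
    obtain ⟨Z, hZ, hZa⟩ := hA H hH ι
    -- For the empty graph the fibre size is arbitrary and could be 0, so it is replaced by 1.
    obtain ⟨N, hNpos, hN⟩ : ∃ N, 0 < N ∧ HasFibres φ N := by
      cases isEmpty_or_nonempty G.V with
      | inl hempty => exact ⟨1, one_pos, fun v => isEmptyElim v⟩
      | inr hne =>
        obtain ⟨v⟩ := hne
        obtain ⟨u, hu⟩ := hφ.1 v
        exact ⟨N, hN v ▸ (Set.ncard_pos (Set.toFinite _)).mpr ⟨u, hu⟩, hN⟩
    refine ⟨H, Z, N, hNpos, hZa, ?_, fun Y hY => ⟨liftSolution φ Pi.kind Y,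
      (feasible_liftSolution_iff hC hG hH P hφ Y).mpr hY, ncard_liftSolution hφ hN _ Y⟩⟩
    have hlocal : ∀ u ∉ {w | ¬ LabelsMatch Δ H ι.port (fun u v => P.port (φ u) (φ v)) Pi.kind
        (A.run ι w) (x (φ w)) w},
        localSolution H Pi.kind Z u = localSolution H Pi.kind (liftSolution φ Pi.kind X) u :=
      fun u hu => localSolution_eq_of_labelsMatch hZ (hX.liftSolution hφ) (hιport H hH ι)
        (fun a b hab => (P.port_lt_deg (hφ.map_adj hab)).trans_le (hΔ G hG _)) (not_not.mp hu)
    have h1 := multiplicity_mul_ncard_le (hΔ H hH) hlocal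
    have h2 := multiplicity_mul_ncard_le (hΔ H hH) fun u hu => (hlocal u hu).symm
    rw [ncard_liftSolution hφ hN] at h1 h2
    have hbad : ((Δ + 1 : ℝ) * {w | ¬ LabelsMatch Δ H ι.port (fun u v => P.port (φ u) (φ v))
        Pi.kind (A.run ι w) (x (φ w)) w}.ncard) ≤ N * δ := by
      refine (mul_le_mul_of_nonneg_left hbad (by positivity)).trans ?_
      rw [hN.card_eq, hc]
      have h3 : (Δ + 1 : ℝ) * (δ / ((Δ + 1 : ℝ) * (Nat.card G.V + 1)) * ((N * Nat.card G.V : ℕ) : ℝ))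
          = N * δ * (Nat.card G.V / (Nat.card G.V + 1)) := by
        push_cast
        field_simp
      rw [h3]
      refine mul_le_of_le_one_right (by positivity) ?_
      rw [div_le_one (by positivity)]
      linarith
    have hmul : (1 : ℝ) ≤ Pi.kind.multiplicity := by
      cases Pi.kind <;> simp [SolutionKind.multiplicity]
    have h1' : (Pi.kind.multiplicity : ℝ) * Z.ncard ≤
        Pi.kind.multiplicity * (N * X.ncard) + N * δ :=
      (show (Pi.kind.multiplicity : ℝ) * Z.ncard ≤ _ by exact_mod_cast h1).trans
        (add_le_add_right hbad _)
    have h2' : (Pi.kind.multiplicity : ℝ) * (N * X.ncard) ≤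
        Pi.kind.multiplicity * Z.ncard + N * δ :=
      (show (Pi.kind.multiplicity : ℝ) * (N * X.ncard) ≤ _ by exact_mod_cast h2).trans
        (add_le_add_right hbad _)
    refine le_trans (le_mul_of_one_le_left (abs_nonneg _) hmul) ?_
    rw [← abs_of_pos (one_pos.trans_le hmul), ← abs_mul, abs_le]
    constructor <;> linarith
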